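/- Let $K,U\ge 1$. A perimeter has cells $1,\dots,K$ and is searched by agents $1,\dots,U$. An action is a vector $\mathbf a=(a_1,\dots,a_K)\in\{0,1,\dots,U\}^K$, where $a_k=u\ne 0$ means that agent $u$ searches cell $k$ and $a_k=0$ that cell $k$ is unsearched, such that the cells searched by any one agent are contiguous; $\mathcal A$ is the set of actions. Under action $\mathbf a$ an event in cell $k$ is detected with a known probability $\gamma_k(\mathbf a)\in[0,1]$, which is positive if $a_k\neq 0$, is $0$ if $a_k=0$, and depends only on the agent searching cell $k$ and the sub-region assigned to that agent. In each round $t=1,2,\dots$ a policy chooses an action $\mathbf a_t\in\mathcal A$ as a function of the past actions and observations; independently over cells and rounds, $X_{k,t}\sim\mathrm{Pois}(\lambda_k)$ events occur in cell $k$, with unknown $\lambda_k\ge 0$, and $Y_{k,t}\sim\mathrm{Bin}(X_{k,t},\gamma_k(\mathbf a_t))$ of them are observed. Put $r_{\boldsymbol\lambda}(\mathbf a)=\sum_k\gamma_k(\mathbf a)\lambda_k$, $\mathrm{opt}=\max_{\mathbf a\in\mathcal A}r_{\boldsymbol\lambda}(\mathbf a)$, and $\mathrm{Reg}(n)=n\,\mathrm{opt}-\mathbb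 E\sum_{t=1}^n r_{\boldsymbol\lambda}(\mathbf a_t)$. Let $\lambda_{\max}\ge\max_k\lambda_k$ be known. The FP-CUCB algorithm with parameter $\lambda_{\max}$ selects, in each round $t\le K$, an arbitrary action with $a_t\ne 0$ (cell $t$ is searched), and in each round $t>K$ an action maximising $r_{\bar{\boldsymbol\lambda}_t}$ over $\mathcal A$ (ties broken arbitrarily), where, with $D_{k,t-1}=\sum_{s=1}^{t-1}\gamma_k(\mathbf a_s)$, $$\bar\lambda_{k,t}=\frac{\sum_{s=1}^{t-1}Y_{k,s}}{D_{k,t-1}}+\frac{2\log t}{D_{k,t-1}}+\sqrt{\frac{6\lambda_{\max}\log t}{D_{k,t-1}}} .$$ For each cell $k$ let $\Delta^k_{\max}=\mathrm{opt}-\min_{\mathbf a\in\mathcal A:\,a_k\ne0}r_{\boldsymbol\lambda}(\mathbf a)$ and $\Delta_{\max}=\max_k\Delta^k_{\max}$. Let $\Delta^k_{\min}$ be the smallest value of $\mathrm{opt}-r_{\boldsymbol\lambda}(\mathbf a)$ over the suboptimal actions $\mathbf a\in\mathcal A$ (those with $r_{\boldsymbol\lambda}(\mathbf a)<\mathrm{opt}$)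 that have $a_k\neq 0$, and $\Delta^k_{\min}=0$ if there is no such action. Let $\gamma_{k,\min}=\min_{\mathbf a\in\mathcal A:\,a_k\ne 0}\gamma_k(\mathbf a)$ and $b(x)=\lambda_{\max}+\sqrt{\lambda_{\max}^2+x^2/(9K^2)}$. Theorem. The regret of the FP-CUCB algorithm with parameter $\lambda_{\max}$ satisfies, for every $n$, $$\mathrm{Reg}(n)\le\sum_{k:\Delta^k_{\min}>0}\frac{12K^2}{\gamma_{k,\min}}\left[\frac{b(\Delta^k_{\min})}{\Delta^k_{\min}}+\int_{\Delta^k_{\min}}^{\Delta^k_{\max}}\frac{b(x)}{x^2}\,dx\right]\log n+\left(\frac{\pi^2}{3}+1\right)K\,\Delta_{\max}.$$ -/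

import Mathlib

open scoped NNReal

noncomputable section

namespace Surveillance

/-- Deployments of `U` agents over `K` cells: `a k = 0` means that cell `k` is unsearched, and
`a k = u ≠ 0` that agent `u` searches it. The cells searched by any one agent are contiguous. -/
def Action (K U : ℕ) : Type :=
  {a : Fin K → Fin (U + 1) //
    ∀ i j : Fin K, i < j → a i = a j → a i ≠ 0 → ∀ k, i ≤ k → k ≤ j → a k = a i}

namespace Action

variable {K U : ℕ}

instance : CoeFun (Action K U) (fun _ => Fin K → Fin (U + 1)) := ⟨Subtype.val⟩

instance : MeasurableSpace (Action K U) := ⊤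

/-- Agent `u` is assigned to the cells `i, …, j` and to no others. -/
def Assigns (a : Action K U) (i j : Fin K) (u : Fin (U + 1)) : Prop :=
  ∀ k, a k = u ↔ i ≤ k ∧ k ≤ j

end Action

/-- The (known) detection probabilities `γ_k(a)` of a perimeter with `K` cells and `U` agents. -/
structure Detection (K U : ℕ) where
  /-- the probability that an event in cell `k` is detected under action `a` -/
  prob : Action K U → Fin K → unitInterval
  /-- a searched cell has a positive detection probability -/
  prob_pos : ∀ a k, a k ≠ 0 → 0 < prob a k
  /-- nothing is detected in an unsearched cell -/
  prob_unsearched : ∀ a k, a k = 0 → prob a k = 0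
  /-- the detection probability in a cell depends only on the agent searching it and on the
  sub-region assigned to that agent -/
  prob_local : ∀ (a b : Action K U) (i j : Fin K) (u : Fin (U + 1)), u ≠ 0 → i ≤ j →
    a.Assigns i j u → b.Assigns i j u → ∀ k, i ≤ k → k ≤ j → prob a k = prob b k

/-- What the decision-maker sees in `t` rounds: the action taken and the vector of the numbers of
detected events, for each round. Entry `s` belongs to the round `s + 1` of the usual numbering. -/
abbrev History (K U t : ℕ) : Type := Fin t → Action K U × (Fin K → ℕ)

/-- A policy: the action taken after `t` completed rounds, as a function of the history. -/
abbrev Policy (K U : ℕ) : Type := (t : ℕ) → History K U t → Action K U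

namespace Detection

variable {K U : ℕ} (γ : Detection K U)

/-- The expected number of events detected in one round under the action `a`, for rates `lam`. -/
def reward (lam : Fin K → ℝ) (a : Action K U) : ℝ := ∑ k, (γ.prob a k : ℝ) * lam k

/-- The law of the number of detected events in a single cell: the number `x` of events is Poisson
with mean `rate`, and given `x` the number of detected events is binomial with parameters
`x` and `p`. -/
def filteredLaw (rate : ℝ≥0) (p : unitInterval) : MeasureTheory.Measure ℕ :=
  (ProbabilityTheory.poissonMeasure rate).bind fun x => ProbabilityTheory.binomial x p

/-- The law of the vector of detected events under the action `a`: the cells are independent. -/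
def obsLaw (lam : Fin K → ℝ≥0) (a : Action K U) : MeasureTheory.Measure (Fin K → ℕ) :=
  MeasureTheory.Measure.pi fun k => filteredLaw (lam k) (γ.prob a k)

/-- The law of the history of the first `t` rounds under the policy `pol`: given the past, the
policy selects the next action, and the next observation has the law belonging to it. -/
def historyLaw (lam : Fin K → ℝ≥0) (pol : Policy K U) :
    (t : ℕ) → MeasureTheory.Measure (History K U t)
  | 0 => MeasureTheory.Measure.dirac Fin.elim0
  | t + 1 => (historyLaw lam pol t).bind fun h =>
      (γ.obsLaw lam (pol t h)).map fun y =>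
        Fin.snoc (α := fun _ => Action K U × (Fin K → ℕ)) h (pol t h, y)

/-- The largest expected reward of an action. -/
def opt (lam : Fin K → ℝ) : ℝ := ⨆ a, γ.reward lam a

/-- The expected regret of the policy `pol` over the first `n` rounds. -/
def regret (lam : Fin K → ℝ≥0) (pol : Policy K U) (n : ℕ) : ℝ :=
  n * γ.opt (fun k => lam k) -
    ∫ h, ∑ s : Fin n, γ.reward (fun k => lam k) (h s).1 ∂(γ.historyLaw lam pol n)

/-- The total detection probability applied to cell `k` in the rounds of a history. -/
def exposure {t : ℕ} (h : History K U t) (k : Fin K) : ℝ := ∑ s, (γ.prob (h s).1 k : ℝ)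

/-- The upper confidence index of cell `k` in round `t + 1`, computed from the history of the
first `t` rounds. -/
def index (lmax : ℝ) {t : ℕ} (h : History K U t) (k : Fin K) : ℝ :=
  (∑ s, ((h s).2 k : ℝ)) / γ.exposure h k
    + 2 * Real.log ((t + 1 : ℕ) : ℝ) / γ.exposure h k
    + Real.sqrt (6 * lmax * Real.log ((t + 1 : ℕ) : ℝ) / γ.exposure h k)

/-- The policy `pol` is an FP-CUCB algorithm with parameter `lmax`. In the first `K` rounds it
searches the cells one after another, by arbitrary actions. Afterwards it takes an action (ties
being broken arbitrarily) that is optimal for the indices in place of the rates. The indices make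
sense for the histories in which every cell has been searched, as is the case after the first `K`
rounds. -/
structure IsFPCUCB (lmax : ℝ) (pol : Policy K U) : Prop where
  init : ∀ (t : ℕ) (ht : t < K) (h : History K U t), pol t h ⟨t, ht⟩ ≠ 0
  iter : ∀ (t : ℕ), K ≤ t → ∀ h : History K U t, (∀ k, 0 < γ.exposure h k) →
    ∀ a, γ.reward (γ.index lmax h) a ≤ γ.reward (γ.index lmax h) (pol t h)

/-- The largest gap to the optimum among the actions that search cell `k`. -/
def gapMax (lam : Fin K → ℝ) (k : Fin K) : ℝ :=
  γ.opt lam - ⨅ a : {a : Action K U // a k ≠ 0}, γ.reward lam a.1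

/-- The smallest gap to the optimum among the suboptimal actions that search cell `k`. It is
positive if there is such an action, and `0` (as the infimum of the empty set) if there is none. -/
def gapMin (lam : Fin K → ℝ) (k : Fin K) : ℝ :=
  sInf {d | ∃ a : Action K U, a k ≠ 0 ∧ γ.reward lam a < γ.opt lam ∧
    d = γ.opt lam - γ.reward lam a}

/-- The largest of the gaps `gapMax`. -/
def gapMaxAll (lam : Fin K → ℝ) : ℝ := ⨆ k, γ.gapMax lam k

/-- The smallest detection probability in cell `k` among the actions that search cell `k`. -/
def probMin (k : Fin K) : ℝ := ⨅ a : {a : Action K U // a k ≠ 0}, (γ.prob a.1 k : ℝ)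

end Detection

/-- The function `b(x) = λ_max + √(λ_max² + x² / (9 K²))`. -/
def bfun (K : ℕ) (lmax x : ℝ) : ℝ := lmax + Real.sqrt (lmax ^ 2 + x ^ 2 / (9 * (K : ℝ) ^ 2))

end Surveillance

end

open MeasureTheory ProbabilityTheory
open scoped NNReal ENNReal

/-! ### Laplace transforms of binomially thinned Poisson counts -/

namespace Surveillance

/-! Regret is the sum over rounds of the expected gap of the chosen action. Each of the first `K`
rounds costs at most the largest gap. Afterwards, if no index is below its rate, optimality for the
indices bounds the gap by the sum of the overestimates of the searched cells, weighted by their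
detection probabilities. Hence some searched cell is overestimated by at least `gap / K`
(`IsFPCUCB.exists_index_ge`).

Such a gap is written as an integral over levels `x` and exchanged with the sum over rounds. At
level `x`, rounds in which the responsible cell has small exposure are counted: each adds at least
`probMin` to it (`IsFPCUCB.sum_historyLaw_exposure_lt_le`). Once the exposure is large,
overestimation is improbable by a Chernoff bound for the exponential martingale of the counts
(`historyLaw_index_ge_le`). Integrating the exposure threshold over `x`, with `x` replaced by the
smallest gap below that gap, gives exactly the logarithmic term (`lintegral_sufficientExposure`).

It remains to sum the probabilities that an index is below its rate. The exposure is random and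
adapted, so a tail bound for fixed exposure does not apply. Instead, exponentials are mixed over
tilts measured in standard deviations, with the scale-invariant density `dy / y`. A new observation
rescales these tilts, but invariance makes the expectation of the capped mixture grow by at most a
constant per round. Markov's inequality then gives a tail of order `t * c * log c * exp (-c ^ 2 /
2)` (`historyLaw_shortfall_le`). With `c ^ 2 = 6 * log (t + 1)` this is summable over rounds, with
sum at most `2.74`; the remaining overestimation costs `1 / 3`, and together they stay below `π ^ 2
/ 3`. -/

theorem lintegral_exp_binomial (n : ℕ) (p : unitInterval) (s : ℝ) :
    ∫⁻ y, ENNReal.ofReal (Real.exp (s * y)) ∂binomial n p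
      = ENNReal.ofReal ((1 - p + p * Real.exp s) ^ n) := by
  rw [← ofReal_integral_eq_lintegral_ofReal (integrable_binomial _)
    (Filter.Eventually.of_forall fun _ => (Real.exp_pos _).le), integral_binomial]
  congr 1
  rw [add_comm, add_pow]
  refine Finset.sum_congr (by ext; simp) fun k _ => ?_
  rw [smul_eq_mul, mul_pow, ← Real.exp_nat_mul, mul_comm s]
  ring

theorem lintegral_exp_poisson {q : ℝ} (hq : 0 ≤ q) (r : ℝ≥0) :
    ∫⁻ x, ENNReal.ofReal (q ^ x) ∂poissonMeasure r
      = ENNReal.ofReal (Real.exp (r * (q - 1))) := by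
  rw [poissonMeasure, lintegral_sum_measure]
  simp only [lintegral_smul_measure, lintegral_dirac, smul_eq_mul]
  have h : HasSum (fun n : ℕ => Real.exp (-r) * r ^ n / n.factorial * q ^ n)
      (Real.exp (r * (q - 1))) := by
    convert! (NormedSpace.expSeries_div_hasSum_exp ((r : ℝ) * q)).mul_left (Real.exp (-r)) using 1
    · funext n
      rw [mul_pow]; ring
    · rw [← Real.exp_eq_exp_ℝ, ← Real.exp_add]
      ring_nf
  rw [← h.tsum_eq, ENNReal.ofReal_tsum_of_nonneg (fun n => by positivity) h.summable]
  exact tsum_congr fun n => (ENNReal.ofReal_mul (by positivity)).symm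

namespace Detection

/-- Thinning a Poisson variable leaves it Poisson, with mean `p * rate`; only its exponential
moments are needed later. The case `s = 0` gives total mass one. -/
theorem lintegral_exp_filteredLaw (rate : ℝ≥0) (p : unitInterval) (s : ℝ) :
    ∫⁻ y, ENNReal.ofReal (Real.exp (s * y)) ∂filteredLaw rate p
      = ENNReal.ofReal (Real.exp (p * rate * (Real.exp s - 1))) := by
  have hp := p.2
  rw [filteredLaw, Measure.lintegral_bind (by exact AEMeasurable.of_discrete) AEMeasurable.of_discrete]
  simp only [lintegral_exp_binomial]
  rw [lintegral_exp_poisson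
    (add_nonneg (sub_nonneg.2 hp.2) (mul_nonneg hp.1 (Real.exp_pos _).le))]
  congr 2
  ring

instance (rate : ℝ≥0) (p : unitInterval) : IsProbabilityMeasure (filteredLaw rate p) :=
  ⟨by simpa using lintegral_exp_filteredLaw rate p 0⟩

variable {K U : ℕ} (γ : Detection K U) (lam : Fin K → ℝ≥0) (pol : Policy K U)

instance (a : Action K U) : IsProbabilityMeasure (γ.obsLaw lam a) := by
  unfold obsLaw; infer_instance

theorem lintegral_obsLaw (a : Action K U) (k : Fin K) (f : ℕ → ℝ≥0∞) :
    ∫⁻ y, f (y k) ∂γ.obsLaw lam a = ∫⁻ x, f x ∂filteredLaw (lam k) (γ.prob a k) :=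
  (measurePreserving_eval (fun k => filteredLaw (lam k) (γ.prob a k)) k).lintegral_comp
    (measurable_of_countable f)

theorem lintegral_exp_obsLaw (a : Action K U) (k : Fin K) (s c : ℝ) :
    ∫⁻ y, ENNReal.ofReal (Real.exp (c + s * y k)) ∂γ.obsLaw lam a
      = ENNReal.ofReal (Real.exp (c + γ.prob a k * lam k * (Real.exp s - 1))) := by
  simp only [Real.exp_add c, ENNReal.ofReal_mul (Real.exp_pos c).le]
  rw [lintegral_const_mul _ (measurable_of_countable _),
    γ.lintegral_obsLaw lam a k fun y => ENNReal.ofReal (Real.exp (s * y)),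
    lintegral_exp_filteredLaw]

end Detection

instance {K U : ℕ} : Finite (Action K U) := Subtype.finite

instance {K U : ℕ} : DiscreteMeasurableSpace (Action K U) := ⟨fun _ => trivial⟩

instance {K U t : ℕ} : Countable (History K U t) := by unfold History; infer_instance

instance {K U t : ℕ} : DiscreteMeasurableSpace (History K U t) := by
  unfold History; infer_instance

/-! ### One-step recursion for the law of the history -/

namespace Detection

variable {K U : ℕ} (γ : Detection K U) (lam : Fin K → ℝ≥0) (pol : Policy K U)

/-- The history `h` extended by a round with action `a` and observation `y`. -/
def extend {t : ℕ} (h : History K U t) (a : Action K U) (y : Fin K → ℕ) : History K U (t + 1) :=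
  Fin.snoc (α := fun _ => Action K U × (Fin K → ℕ)) h (a, y)

/-- The number of events detected in cell `k`. -/
def detected {t : ℕ} (h : History K U t) (k : Fin K) : ℝ := ∑ s, ((h s).2 k : ℝ)

theorem exposure_extend {t : ℕ} (h : History K U t) (a : Action K U) (y : Fin K → ℕ) (k : Fin K) :
    γ.exposure (extend h a y) k = γ.exposure h k + γ.prob a k := by
  simp [exposure, extend, Fin.sum_univ_castSucc]

theorem detected_extend {t : ℕ} (h : History K U t) (a : Action K U) (y : Fin K → ℕ) (k : Fin K) :
    detected (extend h a y) k = detected h k + y k := by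
  simp [detected, extend, Fin.sum_univ_castSucc]

theorem exposure_nonneg {t : ℕ} (h : History K U t) (k : Fin K) : 0 ≤ γ.exposure h k :=
  Finset.sum_nonneg fun s _ => (γ.prob (h s).1 k).2.1

theorem detected_nonneg {t : ℕ} (h : History K U t) (k : Fin K) : 0 ≤ detected h k :=
  Finset.sum_nonneg fun _ _ => Nat.cast_nonneg _

theorem lintegral_historyLaw_succ (t : ℕ) (f : History K U (t + 1) → ℝ≥0∞) :
    ∫⁻ h, f h ∂γ.historyLaw lam pol (t + 1)
      = ∫⁻ h, ∫⁻ y, f (extend h (pol t h) y) ∂γ.obsLaw lam (pol t h) ∂γ.historyLaw lam pol t := by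
  rw [historyLaw, Measure.lintegral_bind (by exact AEMeasurable.of_discrete) AEMeasurable.of_discrete]
  refine lintegral_congr fun h => ?_
  rw [lintegral_map (measurable_of_countable _) (measurable_of_countable _)]
  rfl

instance (t : ℕ) : IsProbabilityMeasure (γ.historyLaw lam pol t) := by
  induction t with
  | zero => rw [historyLaw]; infer_instance
  | succ t ih => exact ⟨by simpa using γ.lintegral_historyLaw_succ lam pol t fun _ => 1⟩

theorem lintegral_historyLaw_zero (f : History K U 0 → ℝ≥0∞) :
    ∫⁻ h, f h ∂γ.historyLaw lam pol 0 = f Fin.elim0 := by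
  rw [historyLaw, lintegral_dirac]

variable {γ lam pol} in
theorem ae_historyLaw_succ {t : ℕ} {P : History K U (t + 1) → Prop}
    (h : ∀ᵐ h ∂γ.historyLaw lam pol t, ∀ y, P (extend h (pol t h) y)) :
    ∀ᵐ h ∂γ.historyLaw lam pol (t + 1), P h := by
  classical
  have := γ.lintegral_historyLaw_succ lam pol t (Set.indicator {h | ¬ P h} 1)
  rw [lintegral_indicator_one (MeasurableSet.of_discrete)] at this
  rw [ae_iff, this, lintegral_eq_zero_iff (measurable_of_countable _)]
  filter_upwards [h] with h hh
  simp [Set.indicator, hh]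

end Detection

/-! ### Analytic estimates for the mixture over tilts -/

/-- A scale-free mixture of exponentials, over the tilts `y ∈ [h, u]` with density `dy / y`. -/
noncomputable def mixture (h u z : ℝ) : ℝ≥0∞ :=
  ∫⁻ y in Set.Icc h u, ENNReal.ofReal (Real.exp (y * z - y ^ 2 / 2) / y)

theorem exp_neg_le_quadratic {x : ℝ} (hx : 0 ≤ x) : Real.exp (-x) ≤ 1 - x + x ^ 2 / 2 := by
  have h1 : 1 + x + x ^ 2 / 2 ≤ Real.exp x := Real.quadratic_le_exp_of_nonneg hx
  rw [Real.exp_neg]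
  refine inv_le_of_inv_le₀ (by nlinarith) (le_trans ?_ h1)
  rw [inv_le_iff_one_le_mul₀ (by nlinarith)]
  nlinarith [sq_nonneg (x ^ 2)]

theorem exp_neg_ge_taylor {x : ℝ} (hx : 0 ≤ x) : 1 - x + x ^ 2 / 2 - x ^ 3 / 6 ≤ Real.exp (-x) := by
  have hd : ∀ y : ℝ, HasDerivAt (fun x : ℝ => Real.exp (-x) - (1 - x + x ^ 2 / 2 - x ^ 3 / 6))
      (-Real.exp (-y) - (-1 + y - y ^ 2 / 2)) y := fun y => by
    have h1 : HasDerivAt (fun x : ℝ => Real.exp (-x)) (-Real.exp (-y)) y := by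
      simpa using (hasDerivAt_neg y).exp
    have h2 : HasDerivAt (fun x : ℝ => 1 - x + x ^ 2 / 2 - x ^ 3 / 6) (-1 + y - y ^ 2 / 2) y := by
      convert! ((((hasDerivAt_const y (1 : ℝ)).sub (hasDerivAt_id y)).add
        ((hasDerivAt_pow 2 y).div_const 2)).sub ((hasDerivAt_pow 3 y).div_const 6)) using 1
      norm_num
      ring
    exact h1.sub h2
  have hmono : MonotoneOn (fun x : ℝ => Real.exp (-x) - (1 - x + x ^ 2 / 2 - x ^ 3 / 6))
      (Set.Ici 0) := by
    refine monotoneOn_of_deriv_nonneg (convex_Ici 0)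
      (fun y _ => (hd y).continuousAt.continuousWithinAt)
      (fun y _ => (hd y).differentiableAt.differentiableWithinAt) fun y hy => ?_
    rw [interior_Ici] at hy
    rw [(hd y).deriv]
    linarith [exp_neg_le_quadratic (le_of_lt hy)]
  have := hmono (Set.self_mem_Ici (a := (0 : ℝ))) (Set.mem_Ici.2 hx) hx
  norm_num at this
  linarith

/-- Laplace's method: for `z ≥ c` the exponent is at least `c ^ 2 / 2 - (y - c) ^ 2 / 2`, and the
mass within `3 / 2` of the peak `y = c` already gives the bound. -/
theorem le_mixture {c z : ℝ} (hc : 2 ≤ c) (hz : c ≤ z) :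
    ENNReal.ofReal (Real.exp (c ^ 2 / 2) * (43 / 20) / c)
      ≤ mixture (1 / (2 * c)) (c + 3 / 2) z := by
  have hc0 : 0 < c := by linarith
  have hsub : Set.Icc (c - 3 / 2) (c + 3 / 2) ⊆ Set.Icc (1 / (2 * c)) (c + 3 / 2) := by
    refine Set.Icc_subset_Icc_left ?_
    rw [div_le_iff₀ (by positivity)]
    nlinarith
  have hpos : ∀ y ∈ Set.Icc (c - 3 / 2) (c + 3 / 2), 0 < y := fun y hy => by
    linarith [hy.1]
  have hcont : ContinuousOn (fun y : ℝ => Real.exp (y * z - y ^ 2 / 2) / y)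
      (Set.Icc (c - 3 / 2) (c + 3 / 2)) := by
    refine ContinuousOn.div (by fun_prop) (by fun_prop) fun y hy => (hpos y hy).ne'
  have hle : c - 3 / 2 ≤ c + 3 / 2 := by linarith
  have hint := hcont.integrableOn_Icc (μ := volume)
  refine le_trans ?_ (lintegral_mono_set hsub)
  rw [← ofReal_integral_eq_lintegral_ofReal hint
    ((ae_restrict_mem measurableSet_Icc).mono fun y hy =>
      div_nonneg (Real.exp_pos _).le (hpos y hy).le),
    integral_Icc_eq_integral_Ioc, ← intervalIntegral.integral_of_le hle]
  refine ENNReal.ofReal_le_ofReal ?_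
  -- A polynomial minorant in `s = y - c`: the cubic Taylor bound for `exp (-s ^ 2 / 2)` times the
  -- tangent `(1 - s / c) / c` of `1 / y` at `c`. The odd part integrates to zero over the symmetric
  -- interval, and the even part gives `77163 / 35840`, slightly more than `43 / 20`.
  let Q : ℝ → ℝ := fun s =>
    Real.exp (c ^ 2 / 2) / c * ((1 - s ^ 2 / 2 + s ^ 4 / 8 - s ^ 6 / 48) * (1 - s / c))
  have hQ : ∫ y in (c - 3 / 2)..(c + 3 / 2), Q (y - c)
      = Real.exp (c ^ 2 / 2) / c * (77163 / 35840) := by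
    rw [intervalIntegral.integral_comp_sub_right]
    have : ∀ s ∈ Set.uIcc (c - 3 / 2 - c) (c + 3 / 2 - c), HasDerivAt (fun s : ℝ =>
        Real.exp (c ^ 2 / 2) / c * (s - s ^ 3 / 6 + s ^ 5 / 40 - s ^ 7 / 336
          - (s ^ 2 / 2 - s ^ 4 / 8 + s ^ 6 / 48 - s ^ 8 / 384) / c)) (Q s) s := fun s _ => by
      have h2 := (hasDerivAt_pow 2 s).div_const 2
      have h3 := (hasDerivAt_pow 3 s).div_const 6
      have h4 := (hasDerivAt_pow 4 s).div_const 8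
      have h5 := (hasDerivAt_pow 5 s).div_const 40
      have h6 := (hasDerivAt_pow 6 s).div_const 48
      have h7 := (hasDerivAt_pow 7 s).div_const 336
      have h8 := (hasDerivAt_pow 8 s).div_const 384
      convert! ((((((hasDerivAt_id s).sub h3).add h5).sub h7).sub
        ((((h2.sub h4).add h6).sub h8).div_const c)).const_mul
          (Real.exp (c ^ 2 / 2) / c)) using 1
      simp only [Q]
      push_cast
      ring
    rw [intervalIntegral.integral_eq_sub_of_hasDerivAt this
      (Continuous.intervalIntegrable (by fun_prop) _ _)]
    ring
  calc Real.exp (c ^ 2 / 2) * (43 / 20) / c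
      ≤ Real.exp (c ^ 2 / 2) / c * (77163 / 35840) := by
        rw [mul_div_right_comm]
        exact mul_le_mul_of_nonneg_left (by norm_num) (by positivity)
    _ = ∫ y in (c - 3 / 2)..(c + 3 / 2), Q (y - c) := hQ.symm
    _ ≤ _ := by
        refine intervalIntegral.integral_mono_on hle
          (Continuous.intervalIntegrable (by fun_prop) _ _)
          ((intervalIntegrable_iff_integrableOn_Icc_of_le hle).2 hint) fun y hy => ?_
        have hy0 := hpos y hy
        have h1 : 1 - (y - c) ^ 2 / 2 + (y - c) ^ 4 / 8 - (y - c) ^ 6 / 48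
            ≤ Real.exp (-((y - c) ^ 2 / 2)) := by
          refine le_trans (le_of_eq ?_) (exp_neg_ge_taylor (x := (y - c) ^ 2 / 2) (by positivity))
          ring
        have h2 : 0 ≤ 1 - (y - c) / c := by
          rw [sub_nonneg, div_le_one hc0]; linarith [hy.2]
        have h3 : 1 / c * (1 - (y - c) / c) ≤ 1 / y := by
          rw [le_div_iff₀ hy0]
          have : 1 / c * (1 - (y - c) / c) * y = 1 - (y / c - 1) ^ 2 := by field_simp; ring
          rw [this]; nlinarith [sq_nonneg (y / c - 1)]
        calc Q (y - c) ≤ Real.exp (c ^ 2 / 2) / c *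
              (Real.exp (-((y - c) ^ 2 / 2)) * (1 - (y - c) / c)) := by
              simp only [Q]; gcongr
          _ = Real.exp (c ^ 2 / 2 + -((y - c) ^ 2 / 2)) * (1 / c * (1 - (y - c) / c)) := by
              rw [Real.exp_add]; ring
          _ ≤ Real.exp (y * z - y ^ 2 / 2) * (1 / y) := by
              refine mul_le_mul (Real.exp_le_exp.2 ?_) h3 (by positivity) (Real.exp_pos _).le
              nlinarith
          _ = _ := by ring

theorem exp_mul_le_chord {c h x z : ℝ} (hh : 0 < h) (hx0 : 0 ≤ x) (hxh : x ≤ h) (hz : z ≤ c) :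
    Real.exp (x * z) ≤ 1 + x / h * (Real.exp (c * h) - 1) := by
  have := convexOn_exp.2 (Set.mem_univ 0) (Set.mem_univ (c * h))
    (sub_nonneg.2 ((div_le_one hh).2 hxh)) (div_nonneg hx0 hh.le) (by ring)
  simp only [smul_eq_mul, mul_zero, zero_add, Real.exp_zero, mul_one] at this
  refine (Real.exp_le_exp.2 ?_).trans (this.trans (le_of_eq (by ring)))
  calc x * z ≤ x * c := by gcongr
    _ = x / h * (c * h) := by field_simp

theorem lintegral_inv_Icc {h u : ℝ} (hh : 0 < h) (hu : h ≤ u) :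
    ∫⁻ y in Set.Icc h u, ENNReal.ofReal (1 / y) = ENNReal.ofReal (Real.log (u / h)) := by
  have hcont : ContinuousOn (fun y : ℝ => 1 / y) (Set.Icc h u) :=
    continuousOn_const.div continuousOn_id fun y hy => (hh.trans_le hy.1).ne'
  rw [← ofReal_integral_eq_lintegral_ofReal hcont.integrableOn_Icc
    ((ae_restrict_mem measurableSet_Icc).mono fun y hy => by
      have := hh.trans_le hy.1; positivity),
    integral_Icc_eq_integral_Ioc, ← intervalIntegral.integral_of_le hu,
    integral_one_div_of_pos hh (hh.trans_le hu)]

theorem lintegral_comp_mul_left {ρ : ℝ} (hρ : 0 < ρ) (F : ℝ → ℝ≥0∞) (hF : Measurable F) :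
    ENNReal.ofReal ρ * ∫⁻ y, F (ρ * y) = ∫⁻ y, F y := by
  have h := Real.smul_map_volume_mul_left hρ.ne'
  rw [abs_of_pos hρ] at h
  conv_rhs => rw [← h]
  rw [lintegral_smul_measure, lintegral_map hF (by fun_prop), smul_eq_mul]

/-- Substituting `ρ * y` for `y` preserves `dy / y`, so tilts with `ρ * y ≥ h` are absorbed by the
mixture itself. Those pushed below `h` have an exponential below the chord over `[0, h]`; its
constant part integrates to at most `log (u / h)` and its linear part to at most `exp (c * h) - 1`,
uniformly in `ρ`. -/
theorem lintegral_contracted_le {c h u ρ z : ℝ} (hc : 0 ≤ c) (hh : 0 < h) (hu : h ≤ u) (hρ : 0 < ρ)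
    (hρ1 : ρ ≤ 1) (hz : z ≤ c) :
    ∫⁻ y in Set.Icc h u, ENNReal.ofReal (Real.exp (ρ * y * z - (ρ * y) ^ 2 / 2) / y)
      ≤ mixture h u z + ENNReal.ofReal (Real.log (u / h) + (Real.exp (c * h) - 1)) := by
  set F : ℝ → ℝ≥0∞ := Set.indicator (Set.Icc h u)
    fun y => ENNReal.ofReal (Real.exp (y * z - y ^ 2 / 2) / y) with hFdef
  have hF : Measurable F := Measurable.indicator (by fun_prop) measurableSet_Icc
  set B := (Real.exp (c * h) - 1) / h with hB
  have hE : 0 ≤ Real.exp (c * h) - 1 := sub_nonneg.2 (Real.one_le_exp (by positivity))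
  have hB0 : 0 ≤ B := by positivity
  have hpt : ∀ y, Set.indicator (Set.Icc h u)
      (fun y => ENNReal.ofReal (Real.exp (ρ * y * z - (ρ * y) ^ 2 / 2) / y)) y
      ≤ ENNReal.ofReal ρ * F (ρ * y) + (Set.indicator (Set.Icc h u)
          (fun y => ENNReal.ofReal (1 / y)) y
        + Set.indicator (Set.Icc h (h / ρ)) (fun _ => ENNReal.ofReal (ρ * B)) y) := fun y => by
    by_cases hy : y ∈ Set.Icc h u
    swap
    · simp [Set.indicator_of_notMem hy]
    have hy0 : 0 < y := hh.trans_le hy.1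
    rw [Set.indicator_of_mem hy]
    by_cases hρy : h ≤ ρ * y
    · have : ρ * y ∈ Set.Icc h u := ⟨hρy, by nlinarith [hy.2]⟩
      refine le_add_right ?_
      rw [hFdef, Set.indicator_of_mem this, ← ENNReal.ofReal_mul hρ.le]
      refine ENNReal.ofReal_le_ofReal (le_of_eq ?_)
      field_simp
    · push Not at hρy
      have hy' : y ∈ Set.Icc h (h / ρ) := ⟨hy.1, by rw [le_div_iff₀ hρ]; linarith⟩
      refine le_add_left ?_
      rw [Set.indicator_of_mem hy, Set.indicator_of_mem hy',
        ← ENNReal.ofReal_add (by positivity) (by positivity)]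
      refine ENNReal.ofReal_le_ofReal ?_
      have h1 : Real.exp (ρ * y * z - (ρ * y) ^ 2 / 2) ≤ 1 + ρ * y / h * (Real.exp (c * h) - 1) :=
        (Real.exp_le_exp.2 (by nlinarith [sq_nonneg (ρ * y)])).trans
          (exp_mul_le_chord hh (by positivity) hρy.le hz)
      rw [div_le_iff₀ hy0]
      refine h1.trans (le_of_eq ?_)
      rw [hB]; field_simp
  rw [← lintegral_indicator measurableSet_Icc]
  refine (lintegral_mono hpt).trans ?_
  have hlog : 0 ≤ Real.log (u / h) := Real.log_nonneg ((one_le_div hh).2 hu)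
  rw [lintegral_add_left (by fun_prop), lintegral_const_mul _ (by fun_prop),
    lintegral_comp_mul_left hρ F hF, lintegral_add_left (Measurable.indicator (by fun_prop)
      measurableSet_Icc), lintegral_indicator measurableSet_Icc,
    lintegral_indicator measurableSet_Icc, lintegral_inv_Icc hh hu,
    lintegral_indicator measurableSet_Icc, ENNReal.ofReal_add hlog hE]
  refine add_le_add le_rfl (add_le_add le_rfl ?_)
  rw [setLIntegral_const, Real.volume_Icc, ← ENNReal.ofReal_mul (by positivity)]
  refine ENNReal.ofReal_le_ofReal ?_
  have : ρ * B * (h / ρ - h) = (Real.exp (c * h) - 1) * (1 - ρ) := by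
    rw [hB]; field_simp
  rw [this]
  nlinarith

/-! ### Tail of the self-normalised shortfall at random exposure -/

namespace Detection

variable {K U : ℕ} (γ : Detection K U) (lam : Fin K → ℝ≥0) (pol : Policy K U)

/-- The expected number, given the actions, of events detected in cell `k`. -/
noncomputable def compensator {t : ℕ} (h : History K U t) (k : Fin K) : ℝ :=
  lam k * γ.exposure h k

/-- A bounded function of the standardised shortfall of the detections in cell `k`. It is largest
if the shortfall is at least `c` standard deviations. -/
noncomputable def shortfallPotential (c : ℝ) {t : ℕ} (h : History K U t) (k : Fin K) : ℝ≥0∞ :=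
  if γ.compensator lam h k = 0 then 0 else
    min (mixture (1 / (2 * c)) (c + 3 / 2)
        ((γ.compensator lam h k - detected h k) / √(γ.compensator lam h k)))
      (ENNReal.ofReal (Real.exp (c ^ 2 / 2) * (43 / 20) / c))

/-- The Poisson Laplace transform at negative argument is sub-Gaussian by `exp_neg_le_quadratic`, so
the new variance `w` cancels its share of `x ^ 2 / 2` and only the share of `v` survives. This is
the old exponent at the contracted tilt `√(v / (v + w)) * x`. -/
theorem lintegral_mixture_obsLaw_le {h u v w R : ℝ} (hh : 0 < h) (hw : 0 ≤ w)
    (hvw : 0 < v + w) (a : Action K U) (k : Fin K) (hwk : (γ.prob a k : ℝ) * lam k = w) :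
    ∫⁻ y, mixture h u ((R + w - y k) / √(v + w)) ∂γ.obsLaw lam a
      ≤ ∫⁻ x in Set.Icc h u,
          ENNReal.ofReal (Real.exp (x * R / √(v + w) - x ^ 2 * v / (2 * (v + w))) / x) := by
  unfold mixture
  rw [lintegral_lintegral_swap]
  swap
  · refine Measurable.aemeasurable (measurable_from_prod_countable_right fun y => ?_)
    simp only [Function.uncurry_apply_pair]
    fun_prop
  refine setLIntegral_mono (by fun_prop) fun x hx => ?_
  have hx0 : 0 < x := hh.trans_le hx.1
  have hs : 0 < √(v + w) := Real.sqrt_pos.2 hvw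
  have hs2 : √(v + w) ^ 2 = v + w := Real.sq_sqrt hvw.le
  have h1 : ∀ y : Fin K → ℕ,
      ENNReal.ofReal (Real.exp (x * ((R + w - y k) / √(v + w)) - x ^ 2 / 2) / x)
        = ENNReal.ofReal (1 / x) * ENNReal.ofReal (Real.exp
          ((x * (R + w) / √(v + w) - x ^ 2 / 2) + (-(x / √(v + w))) * y k)) := fun y => by
    rw [← ENNReal.ofReal_mul (by positivity)]
    congr 1
    rw [one_div, ← div_eq_inv_mul]
    congr 2
    ring
  simp only [h1]
  rw [lintegral_const_mul _ (measurable_of_countable _), lintegral_exp_obsLaw,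
    ← ENNReal.ofReal_mul (by positivity), one_div, mul_comm, ← div_eq_mul_inv]
  refine ENNReal.ofReal_le_ofReal (div_le_div_of_nonneg_right (Real.exp_le_exp.2 ?_) hx0.le)
  rw [hwk]
  have h2 := mul_le_mul_of_nonneg_left
    (exp_neg_le_quadratic (x := x / √(v + w)) (by positivity)) hw
  have h3 : (x / √(v + w)) ^ 2 = x ^ 2 / (v + w) := by rw [div_pow, hs2]
  rw [h3] at h2
  have h4 : x ^ 2 * v / (2 * (v + w)) = x ^ 2 / 2 - w * (x ^ 2 / (v + w) / 2) := by
    field_simp; ring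
  rw [h4]
  have h5 : x * (R + w) / √(v + w) = x * R / √(v + w) + w * (x / √(v + w)) := by ring
  rw [h5]
  linarith

theorem lintegral_shortfallPotential_extend_le {c : ℝ} (hc : 2 ≤ c) {t : ℕ} (h : History K U t)
    (a : Action K U) (k : Fin K) :
    ∫⁻ y, γ.shortfallPotential lam c (extend h a y) k ∂γ.obsLaw lam a
      ≤ γ.shortfallPotential lam c h k
        + ENNReal.ofReal (Real.log (2 * c ^ 2 + 3 * c) + (Real.exp (1 / 2) - 1)) := by
  have hc0 : 0 < c := by linarith
  set v := γ.compensator lam h k with hvdef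
  set w := (γ.prob a k : ℝ) * lam k with hw
  have hv0 : 0 ≤ v := mul_nonneg (lam k).2 (γ.exposure_nonneg h k)
  have hw0 : 0 ≤ w := mul_nonneg (γ.prob a k).2.1 (lam k).2
  have hext : ∀ y, γ.compensator lam (extend h a y) k = v + w := fun y => by
    rw [compensator, exposure_extend, hvdef, compensator, hw]; ring
  have hh : 0 < 1 / (2 * c) := by positivity
  have hu : 1 / (2 * c) ≤ c + 3 / 2 := by
    rw [div_le_iff₀ (by positivity)]; nlinarith
  have hE : 0 ≤ Real.exp (1 / 2) - 1 := sub_nonneg.2 (Real.one_le_exp (by norm_num))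
  have hratio : (c + 3 / 2) / (1 / (2 * c)) = 2 * c ^ 2 + 3 * c := by field_simp
  have hlog : 0 ≤ Real.log (2 * c ^ 2 + 3 * c) := Real.log_nonneg (by nlinarith)
  by_cases hvw : v + w = 0
  · simp [shortfallPotential, hext, hvw]
  have hvw0 : 0 < v + w := lt_of_le_of_ne (by positivity) (Ne.symm hvw)
  have hs : 0 < √(v + w) := Real.sqrt_pos.2 hvw0
  simp only [shortfallPotential, hext, hvw, if_false, ← hvdef, detected_extend]
  have hstep := γ.lintegral_mixture_obsLaw_le lam (u := c + 3 / 2) (R := v - detected h k)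
    hh hw0 hvw0 a k hw.symm
  have hmix : ∫⁻ y, min (mixture (1 / (2 * c)) (c + 3 / 2)
        ((v + w - (detected h k + y k)) / √(v + w)))
      (ENNReal.ofReal (Real.exp (c ^ 2 / 2) * (43 / 20) / c)) ∂γ.obsLaw lam a
      ≤ ∫⁻ y, mixture (1 / (2 * c)) (c + 3 / 2)
        ((v - detected h k + w - y k) / √(v + w)) ∂γ.obsLaw lam a := by
    refine lintegral_mono fun y => (min_le_left _ _).trans (le_of_eq ?_)
    congr 2
    ring
  -- Without any variance so far the exponent is nonpositive, and `∫ dx / x` alone bounds the first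
  -- positive value.
  by_cases hv : v = 0
  · rw [if_pos hv, zero_add]
    refine (hmix.trans hstep).trans (le_trans (setLIntegral_mono (by fun_prop)
      (g := fun x => ENNReal.ofReal (1 / x)) fun x hx => ?_) ?_)
    · have hx0 : 0 < x := hh.trans_le hx.1
      refine ENNReal.ofReal_le_ofReal (div_le_div_of_nonneg_right (Real.exp_le_one_iff.2 ?_) hx0.le)
      rw [hv]
      have := detected_nonneg h k
      have h2 : x * (0 - detected h k) / √(0 + w) ≤ 0 :=
        div_nonpos_of_nonpos_of_nonneg (by nlinarith) (Real.sqrt_nonneg _)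
      simpa using h2
    · rw [lintegral_inv_Icc hh hu, hratio]
      exact ENNReal.ofReal_le_ofReal (by linarith)
  rw [if_neg hv]
  have hvpos : 0 < v := lt_of_le_of_ne hv0 (Ne.symm hv)
  have hsv : 0 < √v := Real.sqrt_pos.2 hvpos
  -- At the cap the potential cannot increase. Below it, `le_mixture` forces the standardised
  -- shortfall to be at most `c`, which the contraction estimate requires.
  by_cases hF : ENNReal.ofReal (Real.exp (c ^ 2 / 2) * (43 / 20) / c)
      ≤ mixture (1 / (2 * c)) (c + 3 / 2) ((v - detected h k) / √v)
  · rw [min_eq_right hF]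
    refine le_add_right ((lintegral_mono fun y => min_le_right _ _).trans ?_)
    simp
  rw [min_eq_left (not_le.1 hF).le]
  have hz : (v - detected h k) / √v ≤ c := by
    by_contra hz
    exact hF (le_mixture hc (not_le.1 hz).le)
  have hcon := lintegral_contracted_le hc0.le hh hu (ρ := √v / √(v + w)) (by positivity)
    ((div_le_one hs).2 (Real.sqrt_le_sqrt (by linarith))) hz
  rw [hratio, show c * (1 / (2 * c)) = 1 / 2 by field_simp] at hcon
  refine ((hmix.trans hstep).trans (le_of_eq ?_)).trans hcon
  refine setLIntegral_congr_fun measurableSet_Icc fun x _ => ?_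
  have h1 : √v / √(v + w) * x * ((v - detected h k) / √v)
      = x * (v - detected h k) / √(v + w) := by field_simp
  have h2 : (√v / √(v + w) * x) ^ 2 / 2 = x ^ 2 * v / (2 * (v + w)) := by
    rw [mul_pow, div_pow, Real.sq_sqrt hv0, Real.sq_sqrt hvw0.le]; field_simp
  simp only [h1, h2]

theorem lintegral_shortfallPotential_le {c : ℝ} (hc : 2 ≤ c) (t : ℕ) (k : Fin K) :
    ∫⁻ h, γ.shortfallPotential lam c h k ∂γ.historyLaw lam pol t
      ≤ t * ENNReal.ofReal (Real.log (2 * c ^ 2 + 3 * c) + (Real.exp (1 / 2) - 1)) := by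
  induction t with
  | zero =>
    rw [lintegral_historyLaw_zero]
    simp [shortfallPotential, compensator, exposure]
  | succ t ih =>
    rw [lintegral_historyLaw_succ]
    refine (lintegral_mono fun h =>
      γ.lintegral_shortfallPotential_extend_le lam hc h (pol t h) k).trans ?_
    rw [lintegral_add_right _ measurable_const, lintegral_const, measure_univ, mul_one,
      Nat.cast_succ, add_mul, one_mul]
    exact add_le_add ih le_rfl

/-- The cap is attained whenever the shortfall reaches `c` standard deviations, so Markov's
inequality for the potential applies whatever the random exposure is. -/
theorem historyLaw_shortfall_le {c : ℝ} (hc : 2 ≤ c) (t : ℕ) (k : Fin K) :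
    γ.historyLaw lam pol t {h | 0 < γ.compensator lam h k ∧
        c * √(γ.compensator lam h k) ≤ γ.compensator lam h k - detected h k}
      ≤ ENNReal.ofReal (t * (c * (Real.log (2 * c ^ 2 + 3 * c) + (Real.exp (1 / 2) - 1)))
          / (Real.exp (c ^ 2 / 2) * (43 / 20))) := by
  have hc0 : 0 < c := by linarith
  set F := Real.exp (c ^ 2 / 2) * (43 / 20) / c with hF
  have hF0 : 0 < F := by positivity
  have hE : 0 ≤ Real.exp (1 / 2) - 1 := sub_nonneg.2 (Real.one_le_exp (by norm_num))
  have hlog : 0 ≤ Real.log (2 * c ^ 2 + 3 * c) := Real.log_nonneg (by nlinarith)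
  have hmarkov := mul_meas_ge_le_lintegral (μ := γ.historyLaw lam pol t)
    (f := fun h => γ.shortfallPotential lam c h k) (measurable_of_countable _) (ENNReal.ofReal F)
  have h1 := hmarkov.trans (γ.lintegral_shortfallPotential_le lam pol hc t k)
  have h2 : γ.historyLaw lam pol t {h | 0 < γ.compensator lam h k ∧
        c * √(γ.compensator lam h k) ≤ γ.compensator lam h k - detected h k}
      ≤ γ.historyLaw lam pol t {h | ENNReal.ofReal F ≤ γ.shortfallPotential lam c h k} := by
    refine measure_mono fun h hh => ?_
    have hs : 0 < √(γ.compensator lam h k) := Real.sqrt_pos.2 hh.1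
    simp only [Set.mem_ofPred_eq, shortfallPotential, hh.1.ne', if_false]
    exact le_min (le_mixture hc ((le_div_iff₀ hs).2 hh.2)) le_rfl
  refine h2.trans ?_
  rw [mul_comm, ← ENNReal.le_div_iff_mul_le (Or.inl (ENNReal.ofReal_pos.2 hF0).ne')
    (Or.inl ENNReal.ofReal_ne_top)] at h1
  refine h1.trans (le_of_eq ?_)
  rw [← ENNReal.ofReal_natCast, ← ENNReal.ofReal_mul (by positivity),
    ← ENNReal.ofReal_div_of_pos hF0, hF]
  congr 1
  field_simp

end Detection

/-! ### Numerical estimates making the tails summable -/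

/-- Trades the factor `c * log c` for `exp (c ^ 2 / 12)`, which becomes `√(t + 1)` when `c ^ 2 = 6 *
log (t + 1)`. The two sides are close near `c = 3.5`; hence the logarithm is linearised at `32` and
the exponential expanded at `c ^ 2 / 12 = 1`. -/
theorem mul_log_add_le {c : ℝ} (hc : 12 / 5 ≤ c) :
    c * (Real.log (2 * c ^ 2 + 3 * c) + (Real.exp (1 / 2) - 1))
      ≤ 7 / 2 * Real.exp (c ^ 2 / 12) + 11 / 2 := by
  have hX : 0 < 2 * c ^ 2 + 3 * c := by nlinarith
  have hlog32 : Real.log 32 ≤ 3.4658 := by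
    rw [show (32 : ℝ) = 2 ^ 5 by norm_num, Real.log_pow]
    push_cast
    linarith [Real.log_two_lt_d9]
  have hlog : Real.log (2 * c ^ 2 + 3 * c) ≤ (2 * c ^ 2 + 3 * c) / 32 - 1 + 3.4658 := by
    have := Real.log_le_sub_one_of_pos (show 0 < (2 * c ^ 2 + 3 * c) / 32 by positivity)
    rw [Real.log_div hX.ne' (by norm_num)] at this
    linarith
  have hhalf : Real.exp (1 / 2) ≤ 1.65 := by
    have h1 : Real.exp (1 / 2) * Real.exp (1 / 2) = Real.exp 1 := by
      rw [← Real.exp_add]; norm_num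
    nlinarith [Real.exp_one_lt_d9, Real.exp_pos (1 / 2)]
  have hexp : 2.718 * (1 + (c ^ 2 / 12 - 1) + (c ^ 2 / 12 - 1) ^ 2 / 2 + (c ^ 2 / 12 - 1) ^ 3 / 6)
      ≤ Real.exp (c ^ 2 / 12) := by
    have h1 : 1 + (c ^ 2 / 12 - 1) + (c ^ 2 / 12 - 1) ^ 2 / 2 + (c ^ 2 / 12 - 1) ^ 3 / 6
        ≤ Real.exp (c ^ 2 / 12 - 1) := by
      rcases le_total 0 (c ^ 2 / 12 - 1) with hd | hd
      · have := Real.sum_le_exp_of_nonneg hd 4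
        simp [Finset.sum_range_succ, Nat.factorial] at this
        linarith
      · have := exp_neg_ge_taylor (neg_nonneg.2 hd)
        rw [neg_neg] at this
        refine le_trans (le_of_eq ?_) this
        ring
    have h2 : Real.exp (c ^ 2 / 12) = Real.exp 1 * Real.exp (c ^ 2 / 12 - 1) := by
      rw [← Real.exp_add]; ring_nf
    rw [h2]
    exact (mul_le_mul_of_nonneg_left h1 (by norm_num)).trans
      (mul_le_mul_of_nonneg_right (by linarith [Real.exp_one_gt_d9]) (Real.exp_pos _).le)
  calc _ ≤ c * ((2 * c ^ 2 + 3 * c) / 32 - 1 + 3.4658 + 0.65) := by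
        refine mul_le_mul_of_nonneg_left ?_ (by linarith)
        linarith
    _ ≤ 7 / 2 * (2.718 * (1 + (c ^ 2 / 12 - 1) + (c ^ 2 / 12 - 1) ^ 2 / 2
        + (c ^ 2 / 12 - 1) ^ 3 / 6)) + 11 / 2 := by
        nlinarith [sq_nonneg (c ^ 3 - 43), mul_nonneg (show 0 ≤ c + 8 by linarith)
          (sq_nonneg (c - 4)), sq_nonneg (c - 4)]
    _ ≤ _ := by linarith

theorem shortfall_bound_le_telescope (t : ℕ) :
    t * (7 / 2 * √(t + 1) + 11 / 2) / ((t + 1 : ℝ) ^ 3 * (43 / 20))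
      ≤ 20 / 43 * (7 * (1 / √(t + 1) - 1 / √(t + 2)) + 11 / 2 * (1 / (t + 1) - 1 / (t + 2))) := by
  have ht : (0 : ℝ) ≤ t := Nat.cast_nonneg t
  set p := √((t : ℝ) + 1) with hp
  set q := √((t : ℝ) + 2) with hq
  have hp0 : 0 < p := Real.sqrt_pos.2 (by positivity)
  have hq0 : 0 < q := Real.sqrt_pos.2 (by positivity)
  have hp2 : p ^ 2 = t + 1 := Real.sq_sqrt (by positivity)
  have hq2 : q ^ 2 = t + 2 := Real.sq_sqrt (by positivity)
  have hpq : (q - p) * (q + p) = 1 := by linear_combination hq2 - hp2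
  have h1 : (t : ℝ) * p / (t + 1) ^ 3 ≤ 2 * (1 / p - 1 / q) := by
    have e1 : 2 * (1 / p - 1 / q) = 2 / (p * q * (p + q)) := by
      rw [eq_div_iff (by positivity)]; field_simp; linear_combination hpq
    rw [e1, div_le_div_iff₀ (by positivity) (by positivity), ← hp2]
    have e2 : (t : ℝ) = p ^ 2 - 1 := by linarith
    have e3 : q ^ 2 = p ^ 2 + 1 := by linarith
    have e4 : p * q ≤ p ^ 2 + 1 / 2 := by nlinarith [sq_nonneg (p - q)]
    have e5 : (p ^ 2 - 1) * (p * q + q ^ 2) ≤ 2 * p ^ 4 := by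
      rw [e3]
      have : 0 ≤ p ^ 2 - 1 := by linarith
      nlinarith
    calc (t : ℝ) * p * (p * q * (p + q)) = p ^ 2 * ((p ^ 2 - 1) * (p * q + q ^ 2)) := by
          rw [e2]; ring
      _ ≤ p ^ 2 * (2 * p ^ 4) := by gcongr
      _ = _ := by ring
  have h2 : (t : ℝ) / (t + 1) ^ 3 ≤ 1 / (t + 1) - 1 / (t + 2) := by
    rw [div_sub_div _ _ (by positivity) (by positivity),
      div_le_div_iff₀ (by positivity) (by positivity)]
    nlinarith [pow_nonneg ht 2, pow_nonneg ht 3]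
  have e : (t : ℝ) * (7 / 2 * p + 11 / 2) / ((t + 1) ^ 3 * (43 / 20))
      = 20 / 43 * (7 / 2 * (t * p / (t + 1) ^ 3) + 11 / 2 * (t / (t + 1) ^ 3)) := by
    field_simp
  rw [e]
  linarith

theorem sum_shortfall_bound_le {K : ℕ} (hK : 2 ≤ K) (n : ℕ) :
    ∑ t ∈ Finset.Ico K n, t * (7 / 2 * √(t + 1) + 11 / 2) / ((t + 1 : ℝ) ^ 3 * (43 / 20))
      ≤ 2.74 := by
  have h3 : 1.732 ≤ √3 := Real.le_sqrt_of_sq_le (by norm_num)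
  have key : ∀ f : ℕ → ℝ, (∀ m, 0 ≤ f m) → f 2 ≤ 2.74 → Antitone f →
      ∑ t ∈ Finset.Ico K n, (f t - f (t + 1)) ≤ 2.74 := fun f hf h2 ha => by
    rcases le_total n K with h | h
    · rw [Finset.Ico_eq_empty_of_le h, Finset.sum_empty]
      norm_num
    · rw [← neg_le_neg_iff, ← Finset.sum_neg_distrib]
      simp only [neg_sub]
      rw [Finset.sum_Ico_sub f h]
      linarith [hf n, ha hK]
  refine le_trans (Finset.sum_le_sum fun t _ => ?_)
    -- The telescoping sum is at most its value at `2`, namely `20 / 43 * (7 / √3 + 11 / 6)`, which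
    -- is about `2.732`.
    (key (fun t => 20 / 43 * (7 / √(t + 1) + 11 / 2 / (t + 1))) (fun m => by positivity) ?_ ?_)
  · refine (shortfall_bound_le_telescope t).trans (le_of_eq ?_)
    push_cast
    rw [show (t : ℝ) + 1 + 1 = t + 2 by ring]
    ring
  · norm_num
    have : 7 / √3 ≤ 7 / 1.732 := by gcongr
    norm_num at this
    linarith
  · intro a b hab
    have : (a : ℝ) ≤ b := by exact_mod_cast hab
    dsimp only
    gcongr

/-! ### Deviations of the indices from the rates -/

namespace Detection

variable {K U : ℕ} (γ : Detection K U) (lam : Fin K → ℝ≥0) (pol : Policy K U)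

theorem index_eq (lmax : ℝ) {t : ℕ} (h : History K U t) (k : Fin K) :
    γ.index lmax h k = detected h k / γ.exposure h k + 2 * Real.log (t + 1) / γ.exposure h k
      + √(6 * lmax * Real.log (t + 1) / γ.exposure h k) := by
  simp [index, detected]

/-- Multiplying by the exposure turns the event into a shortfall of at least `√(6 * log (t + 1))`
standard deviations, because the rate is at most `lmax`. The term `2 * log (t + 1)` is simply
dropped. -/
theorem historyLaw_index_lt_le {lmax : ℝ} (k : Fin K) (hk : (lam k : ℝ) ≤ lmax) {t : ℕ}
    (ht : 2 ≤ t) :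
    γ.historyLaw lam pol t {h | 0 < γ.exposure h k ∧ γ.index lmax h k < lam k}
      ≤ ENNReal.ofReal (t * (7 / 2 * √(t + 1) + 11 / 2) / ((t + 1 : ℝ) ^ 3 * (43 / 20))) := by
  have ht2 : (2 : ℝ) ≤ t := by exact_mod_cast ht
  set L := Real.log ((t : ℝ) + 1) with hL
  -- The value `0.96` is `(12 / 5) ^ 2 / 6`, so that `c ≥ 12 / 5`; it holds since `t + 1 ≥ 3 > exp
  -- 1`.
  have hL1 : 0.96 ≤ L := by
    rw [hL, Real.le_log_iff_exp_le (by positivity)]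
    have h1 : Real.exp 0.96 ≤ Real.exp 1 := Real.exp_le_exp.2 (by norm_num)
    linarith [Real.exp_one_lt_d9]
  have hL0 : 0 ≤ L := by linarith
  set c := √(6 * L) with hc
  have hc2 : c ^ 2 = 6 * L := Real.sq_sqrt (by positivity)
  have hc1 : 12 / 5 ≤ c := Real.le_sqrt_of_sq_le (by linarith)
  have e1 : Real.exp (c ^ 2 / 2) = ((t : ℝ) + 1) ^ 3 := by
    rw [hc2, show 6 * L / 2 = (3 : ℕ) * L by push_cast; ring, Real.exp_nat_mul,
      Real.exp_log (by positivity)]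
  have e2 : Real.exp (c ^ 2 / 12) = √((t : ℝ) + 1) := by
    rw [hc2, show 6 * L / 12 = L / 2 by ring, hL, Real.sqrt_eq_rpow,
      Real.rpow_def_of_pos (by positivity)]
    ring_nf
  refine (measure_mono fun h hh => ?_).trans
    ((γ.historyLaw_shortfall_le lam pol (by linarith : 2 ≤ c) t k).trans
      (ENNReal.ofReal_le_ofReal ?_))
  · obtain ⟨hD, hlt⟩ := hh
    rw [index_eq, ← hL] at hlt
    set D := γ.exposure h k
    have hdet := detected_nonneg h k
    have hlam : 0 < (lam k : ℝ) := by
      refine lt_of_le_of_lt ?_ hlt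
      positivity
    have hmul := mul_lt_mul_of_pos_right hlt hD
    have hs : √(6 * lmax * L / D) * D = √(6 * lmax * L * D) := by
      rw [← Real.sqrt_sq hD.le, ← Real.sqrt_mul' _ (sq_nonneg D), Real.sqrt_sq hD.le]
      congr 1
      field_simp
    have hs2 : c * √(lam k * D) ≤ √(6 * lmax * L * D) := by
      rw [hc, ← Real.sqrt_mul (by positivity)]
      refine Real.sqrt_le_sqrt ?_
      have : 0 ≤ 6 * L * D := by positivity
      nlinarith
    have e : (detected h k / D + 2 * L / D + √(6 * lmax * L / D)) * D
        = detected h k + 2 * L + √(6 * lmax * L * D) := by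
      rw [add_mul, add_mul, hs, div_mul_cancel₀ _ hD.ne', div_mul_cancel₀ _ hD.ne']
    rw [e] at hmul
    exact ⟨mul_pos hlam hD, by rw [compensator]; linarith⟩
  · rw [e1]
    gcongr
    rw [← e2]
    exact mul_log_add_le hc1

/-- The exponential martingale of the counts, compensated by the random exposure. -/
theorem lintegral_exp_detected (θ : ℝ) (t : ℕ) (k : Fin K) :
    ∫⁻ h, ENNReal.ofReal (Real.exp (θ * detected h k
      - lam k * γ.exposure h k * (Real.exp θ - 1))) ∂γ.historyLaw lam pol t = 1 := by
  induction t with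
  | zero =>
    rw [lintegral_historyLaw_zero]
    simp [detected, exposure]
  | succ t ih =>
    rw [lintegral_historyLaw_succ, ← ih]
    refine lintegral_congr fun h => ?_
    have : ∀ y : Fin K → ℕ, θ * detected (extend h (pol t h) y) k
        - lam k * γ.exposure (extend h (pol t h) y) k * (Real.exp θ - 1)
        = (θ * detected h k - lam k * (γ.exposure h k + γ.prob (pol t h) k) * (Real.exp θ - 1))
          + θ * y k := fun y => by
      rw [detected_extend, exposure_extend]; ring
    simp only [this]
    rw [lintegral_exp_obsLaw]
    congr 2
    ring

/-- Once the exposure reaches the threshold, the two bonuses take at most `x / 12` and `x / 2`, so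
the empirical rate itself exceeds the truth by `5 / 12 * x`. On this event the martingale exponent
is bounded below by an increasing function of the exposure, so Markov's inequality needs no union
over exposure values. -/
theorem historyLaw_index_ge_le {lmax x : ℝ} (k : Fin K) (hk : (lam k : ℝ) ≤ lmax) (hx : 0 < x)
    (hxl : x ≤ lmax) {n t : ℕ} (ht : t < n) :
    γ.historyLaw lam pol t {h | 0 < γ.exposure h k ∧
        24 * lmax * Real.log n / x ^ 2 ≤ γ.exposure h k ∧ lam k + x ≤ γ.index lmax h k}
      ≤ ENNReal.ofReal (1 / (n * √n)) := by
  have hl : 0 < lmax := hx.trans_le hxl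
  have hn1 : (1 : ℝ) ≤ n := by exact_mod_cast (by omega : 1 ≤ n)
  have hn0 : (0 : ℝ) < n := by linarith
  have hLn : 0 ≤ Real.log n := Real.log_nonneg hn1
  have hL0 : 0 ≤ Real.log ((t : ℝ) + 1) := Real.log_nonneg (by linarith [Nat.cast_nonneg (α := ℝ) t])
  have hL : Real.log ((t : ℝ) + 1) ≤ Real.log n :=
    Real.log_le_log (by positivity) (by exact_mod_cast ht)
  -- With this tilt the exponent is at least `(5 / 36 - 2 / 27) * D * x ^ 2 / lmax`. The coefficient
  -- is `7 / 108`, and `24 * 7 / 108` exceeds `3 / 2`, which gives the power `n ^ (-3 / 2)`.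
  set θ := x / (3 * lmax) with hθ
  have hθ0 : 0 ≤ θ := by positivity
  have hθ1 : θ ≤ 1 / 3 := by
    rw [hθ, div_le_iff₀ (by positivity)]; linarith
  have hψ : Real.exp θ - 1 - θ ≤ 2 / 3 * θ ^ 2 := by
    have := Real.exp_bound' hθ0 (by linarith) (n := 3) (by norm_num)
    norm_num [Finset.sum_range_succ, Nat.factorial] at this
    nlinarith [pow_nonneg hθ0 2]
  have hψ0 : 0 ≤ Real.exp θ - 1 - θ := by linarith [Real.add_one_le_exp θ]
  have hmarkov := mul_meas_ge_le_lintegral (μ := γ.historyLaw lam pol t)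
    (f := fun h => ENNReal.ofReal (Real.exp (θ * detected h k
      - lam k * γ.exposure h k * (Real.exp θ - 1)))) (measurable_of_countable _)
      (ENNReal.ofReal (n * √n))
  rw [lintegral_exp_detected] at hmarkov
  have hn32 : 0 < n * √(n : ℝ) := by positivity
  rw [mul_comm, ← ENNReal.le_div_iff_mul_le (Or.inl (ENNReal.ofReal_pos.2 hn32).ne')
    (Or.inl ENNReal.ofReal_ne_top), ← ENNReal.ofReal_one, ← ENNReal.ofReal_div_of_pos hn32]
    at hmarkov
  refine (measure_mono fun h hh => ?_).trans hmarkov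
  obtain ⟨hD, hND, hidx⟩ := hh
  rw [index_eq] at hidx
  simp only [Set.mem_ofPred_eq]
  refine ENNReal.ofReal_le_ofReal ?_
  set D := γ.exposure h k
  set L := Real.log ((t : ℝ) + 1)
  have hN' : 24 * lmax * Real.log n ≤ D * x ^ 2 := (div_le_iff₀ (by positivity)).1 hND
  have hL24 : 24 * lmax * L ≤ D * x ^ 2 := le_trans (by gcongr) hN'
  have h1 : 2 * L / D ≤ x / 12 := by
    rw [div_le_iff₀ hD]
    have : 24 * lmax * L ≤ D * x * lmax := hL24.trans (by nlinarith [mul_pos hD hx])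
    nlinarith
  have h2 : √(6 * lmax * L / D) ≤ x / 2 := by
    refine Real.sqrt_le_iff.2 ⟨by positivity, ?_⟩
    rw [div_le_iff₀ hD]
    nlinarith
  have h3 : (lam k + 5 / 12 * x) * D ≤ detected h k := by
    rw [← le_div_iff₀ hD]
    linarith
  have h4 : 3 / 2 * Real.log n ≤ θ * detected h k - lam k * D * (Real.exp θ - 1) := by
    have e1 : θ * ((lam k + 5 / 12 * x) * D) ≤ θ * detected h k :=
      mul_le_mul_of_nonneg_left h3 hθ0
    have e2 : lam k * D * (Real.exp θ - 1 - θ) ≤ lmax * D * (2 / 3 * θ ^ 2) := by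
      gcongr
    have e3 : θ * (5 / 12 * x * D) - lmax * D * (2 / 3 * θ ^ 2) = 7 / 108 * (D * x ^ 2) / lmax := by
      rw [hθ]; field_simp; ring
    have e4 : 3 / 2 * Real.log n ≤ 7 / 108 * (D * x ^ 2) / lmax := by
      rw [le_div_iff₀ hl]
      nlinarith [mul_nonneg hl.le hLn]
    linarith
  calc (n : ℝ) * √n = Real.exp (3 / 2 * Real.log n) := by
        rw [show 3 / 2 * Real.log n = Real.log n + Real.log n / 2 by ring, Real.exp_add,
          Real.exp_log hn0, Real.sqrt_eq_rpow, Real.rpow_def_of_pos hn0]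
        ring_nf
    _ ≤ _ := Real.exp_le_exp.2 h4

/-! ### Counting the rounds with small exposure -/

theorem probMin_le {a : Action K U} {k : Fin K} (ha : a k ≠ 0) : γ.probMin k ≤ γ.prob a k :=
  ciInf_le (Set.finite_range _).bddBelow (⟨a, ha⟩ : {a : Action K U // a k ≠ 0})

/-- The action in which agent `1` searches every cell. -/
def sweep (K : ℕ) {U : ℕ} (hU : 0 < U) : Action K U :=
  ⟨fun _ => ⟨1, by omega⟩, fun _ _ _ _ _ _ _ _ => rfl⟩

theorem sweep_ne_zero (hU : 0 < U) (k : Fin K) : sweep K hU k ≠ 0 := by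
  simp [sweep, Fin.ext_iff]

theorem probMin_pos (hU : 0 < U) (k : Fin K) : 0 < γ.probMin k := by
  have : Nonempty {a : Action K U // a k ≠ 0} := ⟨⟨_, sweep_ne_zero hU k⟩⟩
  obtain ⟨a, ha⟩ := exists_eq_ciInf_of_finite (f := fun a : {a : Action K U // a k ≠ 0} =>
    (γ.prob a.1 k : ℝ))
  rw [probMin, ← ha]
  exact γ.prob_pos a.1 k a.2

variable {γ lam pol}

theorem IsFPCUCB.ae_probMin_le_exposure {lmax : ℝ} (hpol : γ.IsFPCUCB lmax pol) (t : ℕ) :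
    ∀ᵐ h ∂γ.historyLaw lam pol t, ∀ k : Fin K, (k : ℕ) < t → γ.probMin k ≤ γ.exposure h k := by
  induction t with
  | zero => exact Filter.Eventually.of_forall fun h k hk => absurd hk (Nat.not_lt_zero _)
  | succ t ih =>
    refine ae_historyLaw_succ ?_
    filter_upwards [ih] with h hh y k hk
    rw [exposure_extend]
    rcases Nat.lt_succ_iff_lt_or_eq.1 hk with hk | hk
    · exact (hh k hk).trans (le_add_of_nonneg_right (γ.prob _ _).2.1)
    · have := hpol.init t (hk ▸ k.2) h
      have hkt : (⟨t, hk ▸ k.2⟩ : Fin K) = k := Fin.ext hk.symm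
      rw [hkt] at this
      exact (γ.probMin_le this).trans (le_add_of_nonneg_left (γ.exposure_nonneg h k))

/-- The truncated exposure `min D (N + g)` rises by at least `g` in every counted round and never
exceeds `N + g`. The first `K` rounds already supply one `g`, which cancels the overshoot and leaves
exactly `N / g`. -/
theorem IsFPCUCB.sum_historyLaw_exposure_lt_le {lmax : ℝ} (hU : 0 < U)
    (hpol : γ.IsFPCUCB lmax pol) (k : Fin K) {N : ℝ} (hN : 0 ≤ N) (n : ℕ) :
    ∑ t ∈ Finset.Ico K n, γ.historyLaw lam pol t {h | pol t h k ≠ 0 ∧ γ.exposure h k < N}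
      ≤ ENNReal.ofReal (N / γ.probMin k) := by
  have hg := γ.probMin_pos hU k
  set g := γ.probMin k with hgdef
  rcases le_total n K with hn | hn
  · simp [Finset.Ico_eq_empty_of_le hn]
  have key : ENNReal.ofReal g + ENNReal.ofReal g *
      ∑ t ∈ Finset.Ico K n, γ.historyLaw lam pol t {h | pol t h k ≠ 0 ∧ γ.exposure h k < N}
      ≤ ∫⁻ h, ENNReal.ofReal (min (γ.exposure h k) (N + g)) ∂γ.historyLaw lam pol n := by
    induction n, hn using Nat.le_induction with
    | base =>
      simp only [Finset.Ico_self, Finset.sum_empty, mul_zero, add_zero]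
      calc ENNReal.ofReal g = ∫⁻ _, ENNReal.ofReal g ∂γ.historyLaw lam pol K := by simp
        _ ≤ _ := lintegral_mono_ae <| by
          filter_upwards [hpol.ae_probMin_le_exposure K] with h hh
          exact ENNReal.ofReal_le_ofReal (le_min (hh k k.2) (by linarith))
    | succ n hn ih =>
      rw [Finset.sum_Ico_succ_top hn, mul_add, ← add_assoc, lintegral_historyLaw_succ]
      refine (add_le_add ih le_rfl).trans ?_
      rw [← lintegral_indicator_const (MeasurableSet.of_discrete),
        ← lintegral_add_left (measurable_of_countable _)]
      refine lintegral_mono fun h => ?_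
      simp only [exposure_extend, lintegral_const, measure_univ, mul_one]
      have hD := γ.exposure_nonneg h k
      have hp := (γ.prob (pol n h) k).2.1
      by_cases hh : h ∈ {h | pol n h k ≠ 0 ∧ γ.exposure h k < N}
      · rw [Set.indicator_of_mem hh, ← ENNReal.ofReal_add (le_min hD (by linarith)) hg.le]
        refine ENNReal.ofReal_le_ofReal (le_min ?_ ?_)
        · exact add_le_add (min_le_left _ _) (γ.probMin_le hh.1)
        · linarith [min_le_left (γ.exposure h k) (N + g), hh.2]
      · rw [Set.indicator_of_notMem hh, add_zero]
        exact ENNReal.ofReal_le_ofReal (min_le_min_right _ (by linarith))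
  have h2 := key.trans (lintegral_mono fun h =>
    ENNReal.ofReal_le_ofReal (min_le_right (γ.exposure h k) (N + g)))
  rw [lintegral_const, measure_univ, mul_one, add_comm N, ENNReal.ofReal_add hg.le hN] at h2
  have h3 := (ENNReal.add_le_add_iff_left ENNReal.ofReal_ne_top).1 h2
  rw [ENNReal.ofReal_div_of_pos hg, ENNReal.le_div_iff_mul_le
    (Or.inl (ENNReal.ofReal_pos.2 hg).ne') (Or.inl ENNReal.ofReal_ne_top), mul_comm]
  exact h3

end Detection

/-! ### Gaps and the decomposition of the regret -/

namespace Detection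

variable {K U : ℕ} (γ : Detection K U) (lam : Fin K → ℝ≥0) (pol : Policy K U)

/-- The amount by which the action `a` falls short of the optimum. -/
noncomputable def gap (l : Fin K → ℝ) (a : Action K U) : ℝ := γ.opt l - γ.reward l a

theorem reward_le_opt (l : Fin K → ℝ) (a : Action K U) : γ.reward l a ≤ γ.opt l :=
  le_ciSup (Set.finite_range _).bddAbove a

theorem gap_nonneg (l : Fin K → ℝ) (a : Action K U) : 0 ≤ γ.gap l a :=
  sub_nonneg.2 (γ.reward_le_opt l a)

theorem exists_reward_eq_opt (hU : 0 < U) (l : Fin K → ℝ) : ∃ a, γ.reward l a = γ.opt l := by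
  have : Nonempty (Action K U) := ⟨sweep K hU⟩
  exact exists_eq_ciSup_of_finite

theorem gap_le_gapMax (l : Fin K → ℝ) {a : Action K U} {k : Fin K} (ha : a k ≠ 0) :
    γ.gap l a ≤ γ.gapMax l k :=
  sub_le_sub_left (ciInf_le (f := fun a : {a : Action K U // a k ≠ 0} => γ.reward l a.1)
    (Set.finite_range _).bddBelow ⟨a, ha⟩) _

theorem gapMax_le_gapMaxAll (l : Fin K → ℝ) (k : Fin K) : γ.gapMax l k ≤ γ.gapMaxAll l :=
  le_ciSup (Set.finite_range _).bddAbove k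

theorem gapMax_nonneg (hU : 0 < U) (l : Fin K → ℝ) (k : Fin K) : 0 ≤ γ.gapMax l k :=
  (γ.gap_nonneg l _).trans (γ.gap_le_gapMax l (sweep_ne_zero hU k))

theorem finite_gaps (l : Fin K → ℝ) (k : Fin K) :
    {d | ∃ a : Action K U, a k ≠ 0 ∧ γ.reward l a < γ.opt l ∧
      d = γ.opt l - γ.reward l a}.Finite :=
  (Set.finite_range (γ.gap l)).subset fun _ ⟨a, _, _, hd⟩ => ⟨a, hd.symm⟩

theorem gapMin_le_gap (l : Fin K → ℝ) {a : Action K U} {k : Fin K} (ha : a k ≠ 0)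
    (hgap : 0 < γ.gap l a) : γ.gapMin l k ≤ γ.gap l a :=
  csInf_le (γ.finite_gaps l k).bddBelow ⟨a, ha, sub_pos.1 hgap, rfl⟩

theorem gapMin_pos (l : Fin K → ℝ) {a : Action K U} {k : Fin K} (ha : a k ≠ 0)
    (hgap : 0 < γ.gap l a) : 0 < γ.gapMin l k := by
  have hne : {d | ∃ a : Action K U, a k ≠ 0 ∧ γ.reward l a < γ.opt l ∧
      d = γ.opt l - γ.reward l a}.Nonempty := ⟨_, a, ha, sub_pos.1 hgap, rfl⟩
  obtain ⟨b, _, hb, hd⟩ := hne.csInf_mem (γ.finite_gaps l k)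
  rw [gapMin, hd]
  exact sub_pos.2 hb

theorem gapMin_le_gapMax (l : Fin K → ℝ) {k : Fin K} (hk : 0 < γ.gapMin l k) :
    γ.gapMin l k ≤ γ.gapMax l k := by
  rcases Set.eq_empty_or_nonempty {d | ∃ a : Action K U, a k ≠ 0 ∧ γ.reward l a < γ.opt l ∧
    d = γ.opt l - γ.reward l a} with h | ⟨d, a, ha, hlt, _⟩
  · rw [gapMin, h, Real.sInf_empty] at hk
    exact absurd hk (lt_irrefl _)
  · exact (γ.gapMin_le_gap l ha (sub_pos.2 hlt)).trans (γ.gap_le_gapMax l ha)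

/-- Ensures that a level `x` in the range of the gaps satisfies `x / K ≤ lmax`, as the Chernoff
bound requires. -/
theorem gapMax_le {lmax : ℝ} (hU : 0 < U) (hlmax : ∀ k, (lam k : ℝ) ≤ lmax) (k : Fin K) :
    γ.gapMax (fun i => lam i) k ≤ K * lmax := by
  have : Nonempty {a : Action K U // a k ≠ 0} := ⟨⟨_, sweep_ne_zero hU k⟩⟩
  obtain ⟨a, ha⟩ := γ.exists_reward_eq_opt hU fun i => lam i
  have h1 : 0 ≤ ⨅ a : {a : Action K U // a k ≠ 0}, γ.reward (fun i => lam i) a.1 :=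
    le_ciInf fun a => Finset.sum_nonneg fun i _ => mul_nonneg (γ.prob a.1 i).2.1 (lam i).2
  have h2 : γ.reward (fun i => lam i) a ≤ K * lmax := by
    have : ∀ i ∈ Finset.univ, (γ.prob a i : ℝ) * lam i ≤ lmax := fun i _ =>
      (mul_le_of_le_one_left (lam i).2 (γ.prob a i).2.2).trans (hlmax i)
    simpa [reward] using Finset.sum_le_card_nsmul Finset.univ _ lmax this
  rw [gapMax, ← ha]
  linarith

theorem lintegral_sum_gap (l : Fin K → ℝ) (n : ℕ) :
    ∫⁻ h, ENNReal.ofReal (∑ s, γ.gap l (h s).1) ∂γ.historyLaw lam pol n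
      = ∑ t ∈ Finset.range n, ∫⁻ h, ENNReal.ofReal (γ.gap l (pol t h)) ∂γ.historyLaw lam pol t := by
  induction n with
  | zero => rw [lintegral_historyLaw_zero]; simp
  | succ n ih =>
    rw [Finset.sum_range_succ, ← ih, lintegral_historyLaw_succ,
      ← lintegral_add_left (measurable_of_countable _)]
    refine lintegral_congr fun h => ?_
    have : ∀ y, ENNReal.ofReal (∑ s, γ.gap l (extend h (pol n h) y s).1)
        = ENNReal.ofReal (∑ s, γ.gap l (h s).1) + ENNReal.ofReal (γ.gap l (pol n h)) := fun y => by
      rw [← ENNReal.ofReal_add (Finset.sum_nonneg fun _ _ => γ.gap_nonneg l _)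
        (γ.gap_nonneg l _), Fin.sum_univ_castSucc]
      simp [extend]
    simp [this]

theorem regret_le_of_lintegral_le {n : ℕ} {B : ℝ} (hB : 0 ≤ B)
    (h : ∑ t ∈ Finset.range n, ∫⁻ h, ENNReal.ofReal (γ.gap (fun i => lam i) (pol t h))
      ∂γ.historyLaw lam pol t ≤ ENNReal.ofReal B) :
    γ.regret lam pol n ≤ B := by
  set l : Fin K → ℝ := fun i => lam i
  have hint : Integrable (fun h : History K U n => ∑ s, γ.reward l (h s).1)
      (γ.historyLaw lam pol n) := by
    refine integrable_finsetSum _ fun s _ => ?_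
    obtain ⟨C, hC⟩ := (Set.finite_range fun a : Action K U => ‖γ.reward l a‖).bddAbove
    exact Integrable.of_bound (measurable_of_countable _).aestronglyMeasurable C
      (Filter.Eventually.of_forall fun h => hC ⟨_, rfl⟩)
  have e : γ.regret lam pol n
      = ∫ h, ∑ s, γ.gap l (h s).1 ∂γ.historyLaw lam pol n := by
    simp only [gap, Finset.sum_sub_distrib]
    rw [integral_sub (integrable_const _) hint, regret]
    simp [l]
  rw [e, integral_eq_lintegral_of_nonneg_ae
    (Filter.Eventually.of_forall fun h => Finset.sum_nonneg fun _ _ => γ.gap_nonneg l _)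
    (measurable_of_countable _).aestronglyMeasurable, lintegral_sum_gap]
  exact ENNReal.toReal_le_of_le_ofReal hB h

/-! ### The gap of a single round after initialisation -/

variable {γ lam pol}

/-- All indices are positive, so an action searching nothing is beaten by `sweep`. This matters
because `gapMaxAll` only controls actions that search some cell. -/
theorem IsFPCUCB.exists_ne_zero {lmax : ℝ} (hK : 0 < K) (hU : 0 < U)
    (hpol : γ.IsFPCUCB lmax pol) {t : ℕ} (ht : K ≤ t) {h : History K U t}
    (hh : ∀ k, 0 < γ.exposure h k) : ∃ k, pol t h k ≠ 0 := by
  by_contra! hz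
  have h1 := hpol.iter t ht h hh (sweep K hU)
  have h2 : γ.reward (γ.index lmax h) (pol t h) = 0 :=
    Finset.sum_eq_zero fun k _ => by rw [γ.prob_unsearched _ _ (hz k)]; simp
  have h3 : 0 < γ.reward (γ.index lmax h) (sweep K hU) := by
    have : Nonempty (Fin K) := ⟨⟨0, hK⟩⟩
    refine Finset.sum_pos (fun k _ => mul_pos ?_ ?_) Finset.univ_nonempty
    · exact γ.prob_pos _ _ (sweep_ne_zero hU k)
    · have hL : 0 < Real.log ((t : ℝ) + 1) :=
        Real.log_pos (by
          have : (0 : ℝ) < t := by exact_mod_cast hK.trans_le ht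
          linarith)
      have := hh k
      have := detected_nonneg h k
      rw [index_eq]
      positivity
  linarith

theorem IsFPCUCB.exists_index_ge {lmax : ℝ} (hK : 0 < K) (hU : 0 < U)
    (hpol : γ.IsFPCUCB lmax pol) {t : ℕ} (ht : K ≤ t) {h : History K U t}
    (hh : ∀ k, 0 < γ.exposure h k) (hopt : ∀ k, (lam k : ℝ) ≤ γ.index lmax h k)
    (hgap : 0 < γ.gap (fun i => lam i) (pol t h)) :
    ∃ k, pol t h k ≠ 0 ∧ lam k + γ.gap (fun i => lam i) (pol t h) / K ≤ γ.index lmax h k := by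
  obtain ⟨a, ha⟩ := γ.exists_reward_eq_opt hU fun i => (lam i : ℝ)
  have h1 : γ.reward (fun i => lam i) a ≤ γ.reward (γ.index lmax h) a :=
    Finset.sum_le_sum fun k _ => mul_le_mul_of_nonneg_left (hopt k) (γ.prob a k).2.1
  have h2 := hpol.iter t ht h hh a
  have h3 : γ.gap (fun i => lam i) (pol t h)
      ≤ ∑ k, (γ.prob (pol t h) k : ℝ) * (γ.index lmax h k - lam k) := by
    simp only [mul_sub, Finset.sum_sub_distrib]
    rw [gap, ← ha]
    exact sub_le_sub_right (h1.trans h2) _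
  have : Nonempty (Fin K) := ⟨⟨0, hK⟩⟩
  have hK0 : (0 : ℝ) < K := by exact_mod_cast hK
  obtain ⟨k, _, hk⟩ := Finset.exists_le_of_sum_le (s := Finset.univ)
    (f := fun _ : Fin K => γ.gap (fun i => lam i) (pol t h) / K) Finset.univ_nonempty
    ((by simp [mul_div_cancel₀ _ hK0.ne'] : _ = γ.gap (fun i => lam i) (pol t h)).trans_le h3)
  have hpos : 0 < γ.gap (fun i => lam i) (pol t h) / K := by positivity
  refine ⟨k, fun h0 => ?_, ?_⟩
  · rw [γ.prob_unsearched _ _ h0] at hk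
    simp at hk
    linarith
  · have := mul_le_of_le_one_left (sub_nonneg.2 (hopt k)) (γ.prob (pol t h) k).2.2
    linarith

/-- The histories after which the cell `k` is searched by an action with gap at least `x`, and the
index of `k` exceeds its rate by at least `x / K`. -/
def overestimated (γ : Detection K U) (lam : Fin K → ℝ≥0) (pol : Policy K U) (lmax : ℝ) (t : ℕ)
    (k : Fin K) (x : ℝ) : Set (History K U t) :=
  {h | 0 < γ.exposure h k ∧ pol t h k ≠ 0 ∧ x ≤ γ.gap (fun i => lam i) (pol t h) ∧
    lam k + x / K ≤ γ.index lmax h k}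

/-- The histories after which the index of the cell `k` is below its rate. -/
def underestimated (γ : Detection K U) (lam : Fin K → ℝ≥0) (lmax : ℝ) (t : ℕ) (k : Fin K) :
    Set (History K U t) :=
  {h | 0 < γ.exposure h k ∧ γ.index lmax h k < lam k}

/-- When no index is too low, the gap is the length of `(0, gap]`, and a single responsible cell
covers every level in it. When some index is too low, the whole gap is charged to that cell at the
price `gapMaxAll`. -/
theorem IsFPCUCB.ofReal_gap_le {lmax : ℝ} (hK : 0 < K) (hU : 0 < U)
    (hpol : γ.IsFPCUCB lmax pol) {t : ℕ} (ht : K ≤ t) {h : History K U t}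
    (hh : ∀ k, 0 < γ.exposure h k) :
    ENNReal.ofReal (γ.gap (fun i => lam i) (pol t h))
      ≤ (∑ k, (γ.underestimated lam lmax t k).indicator
          (fun _ => ENNReal.ofReal (γ.gapMaxAll fun i => lam i)) h)
        + ∑ k with 0 < γ.gapMin (fun i => lam i) k,
          ∫⁻ x in Set.Ioc 0 (γ.gapMax (fun i => lam i) k),
            (γ.overestimated lam pol lmax t k (max x (γ.gapMin (fun i => lam i) k))).indicator
              1 h := by
  by_cases hopt : ∀ k, (lam k : ℝ) ≤ γ.index lmax h k
  · refine le_add_left ?_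
    rcases (γ.gap_nonneg (fun i => lam i) (pol t h)).eq_or_lt with hgap | hgap
    · simp [← hgap]
    obtain ⟨k, hk, hidx⟩ := hpol.exists_index_ge hK hU ht hh hopt hgap
    refine le_trans ?_ (Finset.single_le_sum (fun _ _ => zero_le)
      (Finset.mem_filter.2 ⟨Finset.mem_univ k, γ.gapMin_pos _ hk hgap⟩))
    calc ENNReal.ofReal (γ.gap (fun i => lam i) (pol t h))
        = ∫⁻ _ in Set.Ioc 0 (γ.gap (fun i => lam i) (pol t h)), 1 := by simp
      _ ≤ ∫⁻ x in Set.Ioc 0 (γ.gap (fun i => lam i) (pol t h)),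
            (γ.overestimated lam pol lmax t k (max x (γ.gapMin (fun i => lam i) k))).indicator
              1 h := by
          refine setLIntegral_mono' measurableSet_Ioc fun x hx => ?_
          -- A positive gap is at least `gapMin`, so levels below `gapMin` may be raised to it; this
          -- keeps the later integral of `b(x) / x ^ 2` away from zero.
          have hx' := max_le hx.2 (γ.gapMin_le_gap _ hk hgap)
          rw [Set.indicator_of_mem]
          · simp
          · refine ⟨hh k, hk, hx', le_trans ?_ hidx⟩
            gcongr
      _ ≤ _ := lintegral_mono_set (Set.Ioc_subset_Ioc_right (γ.gap_le_gapMax _ hk))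
  · push Not at hopt
    obtain ⟨k, hk⟩ := hopt
    refine le_add_right (le_trans ?_ (Finset.single_le_sum (fun _ _ => zero_le)
      (Finset.mem_univ k)))
    obtain ⟨j, hj⟩ := hpol.exists_ne_zero hK hU ht hh
    rw [Set.indicator_of_mem (show h ∈ γ.underestimated lam lmax t k from ⟨hh k, hk⟩)]
    exact ENNReal.ofReal_le_ofReal
      ((γ.gap_le_gapMax _ hj).trans (γ.gapMax_le_gapMaxAll _ j))

theorem IsFPCUCB.lintegral_gap_le {lmax : ℝ} (hK : 0 < K) (hU : 0 < U)
    (hpol : γ.IsFPCUCB lmax pol) {t : ℕ} (ht : K ≤ t) :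
    ∫⁻ h, ENNReal.ofReal (γ.gap (fun i => lam i) (pol t h)) ∂γ.historyLaw lam pol t
      ≤ (∑ k, ENNReal.ofReal (γ.gapMaxAll fun i => lam i)
          * γ.historyLaw lam pol t (γ.underestimated lam lmax t k))
        + ∑ k with 0 < γ.gapMin (fun i => lam i) k,
          ∫⁻ x in Set.Ioc 0 (γ.gapMax (fun i => lam i) k),
            γ.historyLaw lam pol t
              (γ.overestimated lam pol lmax t k (max x (γ.gapMin (fun i => lam i) k))) := by
  have hae : ∀ᵐ h ∂γ.historyLaw lam pol t, ENNReal.ofReal (γ.gap (fun i => lam i) (pol t h)) ≤ _ :=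
    (hpol.ae_probMin_le_exposure t).mono fun h hh => hpol.ofReal_gap_le (lam := lam) hK hU ht
      fun k => (γ.probMin_pos hU k).trans_le (hh k (k.2.trans_le ht))
  refine (lintegral_mono_ae hae).trans (le_of_eq ?_)
  rw [lintegral_add_left (measurable_of_countable _),
    lintegral_finsetSum _ fun _ _ => measurable_of_countable _,
    lintegral_finsetSum _ fun _ _ => measurable_of_countable _]
  congr 1
  · refine Finset.sum_congr rfl fun k _ => ?_
    rw [lintegral_indicator_const MeasurableSet.of_discrete]
  · refine Finset.sum_congr rfl fun k _ => ?_
    rw [lintegral_lintegral_swap]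
    · simp only [lintegral_indicator_one MeasurableSet.of_discrete]
    · refine (measurable_from_prod_countable_right fun h => ?_).aemeasurable
      have : (fun x => (γ.overestimated lam pol lmax t k
            (max x (γ.gapMin (fun i => lam i) k))).indicator (1 : History K U t → ℝ≥0∞) h)
          = Set.indicator {x : ℝ | h ∈ γ.overestimated lam pol lmax t k
            (max x (γ.gapMin (fun i => lam i) k))} 1 := by
        funext x; simp [Set.indicator]
      simp only [Function.uncurry_apply_pair]
      rw [this]
      refine measurable_one.indicator ?_
      simp only [overestimated, Set.mem_ofPred_eq]
      measurability

/-! ### Summation over rounds and integration over levels -/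

/-- The exposure at which a cell stops to be responsible for gaps of size `x` in the first `n`
rounds. -/
noncomputable def sufficientExposure (K : ℕ) (lmax : ℝ) (n : ℕ) (x : ℝ) : ℝ :=
  12 * (K : ℝ) ^ 2 * (bfun K lmax x / x ^ 2) * Real.log n

theorem sufficientExposure_nonneg {lmax : ℝ} (hl : 0 ≤ lmax) (n : ℕ) (x : ℝ) :
    0 ≤ sufficientExposure K lmax n x := by
  have : 0 ≤ Real.log n := Real.log_natCast_nonneg n
  unfold sufficientExposure bfun
  positivity

theorem IsFPCUCB.sum_historyLaw_overestimated_le {lmax : ℝ} (hK : 2 ≤ K) (hU : 0 < U)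
    (hpol : γ.IsFPCUCB lmax pol) (hlmax : ∀ k, (lam k : ℝ) ≤ lmax) (k : Fin K) {x : ℝ}
    (hx : 0 < x) (hxl : x ≤ K * lmax) (n : ℕ) :
    ∑ t ∈ Finset.Ico K n, γ.historyLaw lam pol t (γ.overestimated lam pol lmax t k x)
      ≤ ENNReal.ofReal (sufficientExposure K lmax n x / γ.probMin k + 1 / 3) := by
  have hK0 : (0 : ℝ) < K := by exact_mod_cast (by omega : 0 < K)
  have hl0 : 0 ≤ lmax := (lam k).2.trans (hlmax k)
  have hg := γ.probMin_pos hU k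
  have hN := sufficientExposure_nonneg (K := K) hl0 n x
  have hxK : x / K ≤ lmax := by rw [div_le_iff₀ hK0]; linarith
  -- Only `2 * lmax ≤ b(x)` is needed of the function `b`.
  have hNle : 24 * lmax * Real.log n / (x / K) ^ 2 ≤ sufficientExposure K lmax n x := by
    have hL : 0 ≤ Real.log n := Real.log_natCast_nonneg n
    have hb : 2 * lmax ≤ bfun K lmax x := by
      have : lmax ≤ √(lmax ^ 2 + x ^ 2 / (9 * (K : ℝ) ^ 2)) :=
        Real.le_sqrt_of_sq_le (le_add_of_nonneg_right (by positivity))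
      rw [bfun]; linarith
    calc 24 * lmax * Real.log n / (x / K) ^ 2
        = 12 * (K : ℝ) ^ 2 * (2 * lmax / x ^ 2) * Real.log n := by field_simp; ring
      _ ≤ _ := by unfold sufficientExposure; gcongr
  have hsplit : ∀ t ∈ Finset.Ico K n,
      γ.historyLaw lam pol t (γ.overestimated lam pol lmax t k x)
        ≤ γ.historyLaw lam pol t
            {h | pol t h k ≠ 0 ∧ γ.exposure h k < sufficientExposure K lmax n x}
          + ENNReal.ofReal (1 / (n * √n)) := fun t ht => by
    refine le_trans (measure_mono ?_) ((measure_union_le _ _).trans (add_le_add le_rfl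
      (γ.historyLaw_index_ge_le lam pol k (hlmax k) (div_pos hx hK0) hxK
        (Finset.mem_Ico.1 ht).2)))
    intro h hh
    rcases lt_or_ge (γ.exposure h k) (sufficientExposure K lmax n x) with hlt | hge
    · exact Or.inl ⟨hh.2.1, hlt⟩
    · exact Or.inr ⟨hh.1, hNle.trans hge, hh.2.2.2⟩
  refine (Finset.sum_le_sum hsplit).trans ?_
  rw [Finset.sum_add_distrib, ENNReal.ofReal_add (by positivity) (by norm_num)]
  refine add_le_add (hpol.sum_historyLaw_exposure_lt_le hU k hN n) ?_
  rw [Finset.sum_const, nsmul_eq_mul, ← ENNReal.ofReal_natCast,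
    ← ENNReal.ofReal_mul (Nat.cast_nonneg _)]
  refine ENNReal.ofReal_le_ofReal ?_
  rw [Nat.card_Ico]
  rcases le_total n K with hn | hn
  · rw [Nat.sub_eq_zero_of_le hn]; norm_num
  have hn2 : (2 : ℝ) ≤ n := by exact_mod_cast hK.trans hn
  have hK2 : (2 : ℝ) ≤ K := by exact_mod_cast hK
  rw [Nat.cast_sub hn, mul_one_div, div_le_div_iff₀ (by positivity) (by norm_num)]
  have hs : √(n : ℝ) ^ 2 = n := Real.sq_sqrt (by linarith)
  have hs0 := Real.sqrt_nonneg (n : ℝ)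
  -- With `s = √n`, the hint is `(s + 1) * (s - 2) ^ 2 = s ^ 3 - 3 * s ^ 2 + 4`, whence `n * √n ≥ 3
  -- * n - 4 ≥ 3 * (n - K)`.
  nlinarith [mul_nonneg (show 0 ≤ √(n : ℝ) + 1 by linarith) (sq_nonneg (√(n : ℝ) - 2))]

end Detection

namespace Detection

variable {K U : ℕ} {γ : Detection K U} {lam : Fin K → ℝ≥0} {pol : Policy K U}

/-- The contribution of the cell `k` to the logarithmic term of the regret bound. -/
noncomputable def leadingTerm (γ : Detection K U) (lam : Fin K → ℝ≥0) (lmax : ℝ) (n : ℕ)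
    (k : Fin K) : ℝ :=
  12 * (K : ℝ) ^ 2 / γ.probMin k *
    (bfun K lmax (γ.gapMin (fun i => lam i) k) / γ.gapMin (fun i => lam i) k
      + ∫ x in (γ.gapMin (fun i => lam i) k)..(γ.gapMax (fun i => lam i) k),
          bfun K lmax x / x ^ 2) * Real.log n

theorem leadingTerm_nonneg (hU : 0 < U) {lmax : ℝ} (hl : 0 ≤ lmax) (n : ℕ) {k : Fin K}
    (hk : 0 < γ.gapMin (fun i => lam i) k) : 0 ≤ γ.leadingTerm lam lmax n k := by
  have hb : ∀ x, 0 ≤ bfun K lmax x := fun x => by unfold bfun; positivity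
  have hg := γ.probMin_pos hU k
  have hL : 0 ≤ Real.log n := Real.log_natCast_nonneg n
  refine mul_nonneg (mul_nonneg (by positivity) (add_nonneg (div_nonneg (hb _) hk.le) ?_)) hL
  exact intervalIntegral.integral_nonneg (γ.gapMin_le_gapMax _ hk) fun x _ =>
    div_nonneg (hb x) (sq_nonneg x)

/-- Levels below `gapMin` contribute the constant `b(m) / m ^ 2` on length `m`, which is the
boundary term `b(m) / m`; the others give the integral in the theorem. -/
theorem lintegral_sufficientExposure (hU : 0 < U) {lmax : ℝ} (hl : 0 ≤ lmax) (n : ℕ) {k : Fin K}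
    (hk : 0 < γ.gapMin (fun i => lam i) k) :
    ∫⁻ x in Set.Ioc 0 (γ.gapMax (fun i => lam i) k), ENNReal.ofReal
        (sufficientExposure K lmax n (max x (γ.gapMin (fun i => lam i) k)) / γ.probMin k + 1 / 3)
      = ENNReal.ofReal (γ.leadingTerm lam lmax n k + γ.gapMax (fun i => lam i) k / 3) := by
  have hg := γ.probMin_pos hU k
  have hle := γ.gapMin_le_gapMax _ hk
  unfold leadingTerm
  set m := γ.gapMin (fun i => lam i) k
  set M := γ.gapMax (fun i => lam i) k
  set g := γ.probMin k
  set f : ℝ → ℝ := fun x => sufficientExposure K lmax n (max x m) / g + 1 / 3 with hf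
  have hcont : Continuous f := by
    have hb : Continuous fun x => bfun K lmax (max x m) / (max x m) ^ 2 := by
      refine Continuous.div (by unfold bfun; fun_prop) (by fun_prop) fun x => ?_
      have : 0 < max x m := lt_max_of_lt_right hk
      positivity
    simp only [hf, sufficientExposure]
    fun_prop
  have hf0 : ∀ x, 0 ≤ f x := fun x => by
    have := sufficientExposure_nonneg (K := K) hl n (max x m)
    simp only [hf]; positivity
  rw [← ofReal_integral_eq_lintegral_ofReal
    (hcont.integrableOn_Ioc) (Filter.Eventually.of_forall hf0),
    ← intervalIntegral.integral_of_le (hk.le.trans hle),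
    ← intervalIntegral.integral_add_adjacent_intervals (hcont.intervalIntegrable 0 m)
      (hcont.intervalIntegrable m M)]
  congr 1
  have h1 : ∫ x in (0 : ℝ)..m, f x = m * (sufficientExposure K lmax n m / g + 1 / 3) := by
    rw [intervalIntegral.integral_congr (g := fun _ => sufficientExposure K lmax n m / g + 1 / 3)]
    · rw [intervalIntegral.integral_const, sub_zero, smul_eq_mul]
    · intro x hx
      rw [Set.uIcc_of_le hk.le] at hx
      simp only [hf, max_eq_right hx.2]
  have h2 : ∫ x in m..M, f x = ∫ x in m..M,
      (12 * (K : ℝ) ^ 2 / g * Real.log n * (bfun K lmax x / x ^ 2) + 1 / 3) := by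
    refine intervalIntegral.integral_congr fun x hx => ?_
    rw [Set.uIcc_of_le hle] at hx
    simp only [hf, max_eq_left hx.1, sufficientExposure]
    ring
  have hint : IntervalIntegrable (fun x => bfun K lmax x / x ^ 2) volume m M := by
    refine ContinuousOn.intervalIntegrable (ContinuousOn.div (by unfold bfun; fun_prop)
      (by fun_prop) fun x hx => ?_)
    rw [Set.uIcc_of_le hle] at hx
    have : 0 < x := hk.trans_le hx.1
    positivity
  rw [h1, h2, intervalIntegral.integral_add (hint.const_mul _) (by simp),
    intervalIntegral.integral_const_mul, intervalIntegral.integral_const, smul_eq_mul,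
    sufficientExposure]
  field_simp
  ring

theorem overestimated_anti {lmax : ℝ} {t : ℕ} {k : Fin K} {x y : ℝ} (hxy : x ≤ y) :
    γ.overestimated lam pol lmax t k y ⊆ γ.overestimated lam pol lmax t k x :=
  fun _ hh => ⟨hh.1, hh.2.1, hxy.trans hh.2.2.1,
    (add_le_add_right (div_le_div_of_nonneg_right hxy (Nat.cast_nonneg K)) _).trans hh.2.2.2⟩

theorem IsFPCUCB.sum_init_le {lmax : ℝ} (hpol : γ.IsFPCUCB lmax pol) :
    ∑ t ∈ Finset.range K, ∫⁻ h, ENNReal.ofReal (γ.gap (fun i => lam i) (pol t h))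
        ∂γ.historyLaw lam pol t
      ≤ ENNReal.ofReal (K * γ.gapMaxAll fun i => lam i) := by
  have : ∀ t ∈ Finset.range K, ∫⁻ h, ENNReal.ofReal (γ.gap (fun i => lam i) (pol t h))
        ∂γ.historyLaw lam pol t ≤ ENNReal.ofReal (γ.gapMaxAll fun i => lam i) := fun t ht => by
    refine (lintegral_mono fun h => ENNReal.ofReal_le_ofReal
      ((γ.gap_le_gapMax _ (hpol.init t (Finset.mem_range.1 ht) h)).trans
        (γ.gapMax_le_gapMaxAll _ _))).trans (le_of_eq ?_)
    simp
  refine (Finset.sum_le_card_nsmul _ _ _ this).trans (le_of_eq ?_)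
  rw [Finset.card_range, nsmul_eq_mul, ENNReal.ofReal_mul (Nat.cast_nonneg _),
    ENNReal.ofReal_natCast]

theorem IsFPCUCB.sum_main_le {lmax : ℝ} (hK : 2 ≤ K) (hU : 0 < U) (hpol : γ.IsFPCUCB lmax pol)
    (hlmax : ∀ k, (lam k : ℝ) ≤ lmax) (n : ℕ) :
    ∑ t ∈ Finset.Ico K n, ∫⁻ h, ENNReal.ofReal (γ.gap (fun i => lam i) (pol t h))
        ∂γ.historyLaw lam pol t
      ≤ ENNReal.ofReal ((∑ k with 0 < γ.gapMin (fun i => lam i) k, γ.leadingTerm lam lmax n k)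
          + (2.74 + 1 / 3) * K * γ.gapMaxAll fun i => lam i) := by
  have hK0 : 0 < K := by omega
  have hl : 0 ≤ lmax := (lam ⟨0, hK0⟩).2.trans (hlmax _)
  have hM : ∀ k, γ.gapMax (fun i => lam i) k ≤ γ.gapMaxAll fun i => lam i :=
    γ.gapMax_le_gapMaxAll _
  have hM0 : ∀ k, 0 ≤ γ.gapMax (fun i => lam i) k := γ.gapMax_nonneg hU _
  set GM := γ.gapMaxAll fun i => lam i
  have hGM : 0 ≤ GM := (hM0 ⟨0, hK0⟩).trans (hM _)
  have hA : ∀ k ∈ Finset.univ, ∑ t ∈ Finset.Ico K n,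
      ENNReal.ofReal GM * γ.historyLaw lam pol t (γ.underestimated lam lmax t k)
        ≤ ENNReal.ofReal (2.74 * GM) := fun k _ => by
    rw [← Finset.mul_sum, mul_comm (2.74 : ℝ), ENNReal.ofReal_mul hGM]
    gcongr
    refine (Finset.sum_le_sum fun t ht => γ.historyLaw_index_lt_le lam pol k (hlmax k)
      (hK.trans (Finset.mem_Ico.1 ht).1)).trans ?_
    rw [← ENNReal.ofReal_sum_of_nonneg fun t _ => by positivity]
    exact ENNReal.ofReal_le_ofReal (sum_shortfall_bound_le hK n)
  have hB : ∀ k ∈ Finset.univ.filter fun k => 0 < γ.gapMin (fun i => lam i) k,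
      ∑ t ∈ Finset.Ico K n, ∫⁻ x in Set.Ioc 0 (γ.gapMax (fun i => lam i) k),
        γ.historyLaw lam pol t
          (γ.overestimated lam pol lmax t k (max x (γ.gapMin (fun i => lam i) k)))
        ≤ ENNReal.ofReal (γ.leadingTerm lam lmax n k + γ.gapMax (fun i => lam i) k / 3) :=
      fun k hk => by
    have hk := (Finset.mem_filter.1 hk).2
    rw [← lintegral_sufficientExposure hU hl n hk]
    have hmeas : ∀ t ∈ Finset.Ico K n, Measurable fun x => γ.historyLaw lam pol t
        (γ.overestimated lam pol lmax t k (max x (γ.gapMin (fun i => lam i) k))) := fun t _ =>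
      Antitone.measurable fun x y hxy => measure_mono (overestimated_anti (max_le_max_right _ hxy))
    rw [← lintegral_finsetSum _ hmeas]
    refine setLIntegral_mono' measurableSet_Ioc fun x hx => ?_
    exact hpol.sum_historyLaw_overestimated_le hK hU hlmax k (lt_max_of_lt_left hx.1)
      (max_le (hx.2.trans (γ.gapMax_le lam hU hlmax k))
        ((γ.gapMin_le_gapMax _ hk).trans (γ.gapMax_le lam hU hlmax k))) n
  have hlead : ∀ k ∈ Finset.univ.filter fun k => 0 < γ.gapMin (fun i => lam i) k,
      0 ≤ γ.leadingTerm lam lmax n k + γ.gapMax (fun i => lam i) k / 3 := fun k hk =>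
    add_nonneg (leadingTerm_nonneg hU hl n (Finset.mem_filter.1 hk).2)
      (div_nonneg (hM0 k) (by norm_num))
  refine (Finset.sum_le_sum fun t ht =>
    hpol.lintegral_gap_le hK0 hU (Finset.mem_Ico.1 ht).1).trans ?_
  rw [Finset.sum_add_distrib, Finset.sum_comm, Finset.sum_comm (s := Finset.Ico K n)]
  refine (add_le_add (Finset.sum_le_sum hA) (Finset.sum_le_sum hB)).trans ?_
  rw [← ENNReal.ofReal_sum_of_nonneg hlead,
    ← ENNReal.ofReal_sum_of_nonneg fun _ _ => by positivity, ← ENNReal.ofReal_add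
      (Finset.sum_nonneg fun _ _ => by positivity) (Finset.sum_nonneg hlead)]
  refine ENNReal.ofReal_le_ofReal ?_
  rw [Finset.sum_add_distrib]
  have h3 : ∑ k with 0 < γ.gapMin (fun i => lam i) k, γ.gapMax (fun i => lam i) k / 3
      ≤ K * (GM / 3) := by
    calc _ ≤ ∑ k : Fin K, γ.gapMax (fun i => lam i) k / 3 :=
          Finset.sum_le_sum_of_subset_of_nonneg (Finset.filter_subset _ _)
            fun k _ _ => div_nonneg (hM0 k) (by norm_num)
      _ ≤ ∑ _k : Fin K, GM / 3 := Finset.sum_le_sum fun k _ => by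
          have := hM k; linarith
      _ = _ := by simp
  simp only [Finset.sum_const, Finset.card_univ, Fintype.card_fin, nsmul_eq_mul]
  linarith

/-- With one cell, any positive index ranks actions by detection probability alone, as the true rate
does up to ties, so no regret arises after initialisation. -/
theorem IsFPCUCB.sum_main_eq_zero {U : ℕ} {γ : Detection 1 U} {lam : Fin 1 → ℝ≥0}
    {pol : Policy 1 U} {lmax : ℝ} (hU : 0 < U) (hpol : γ.IsFPCUCB lmax pol) (n : ℕ) :
    ∑ t ∈ Finset.Ico 1 n, ∫⁻ h, ENNReal.ofReal (γ.gap (fun i => lam i) (pol t h))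
        ∂γ.historyLaw lam pol t = 0 := by
  refine Finset.sum_eq_zero fun t ht => ?_
  have ht1 := (Finset.mem_Ico.1 ht).1
  rw [lintegral_eq_zero_iff (measurable_of_countable _)]
  filter_upwards [hpol.ae_probMin_le_exposure t] with h hh
  have hD : ∀ k, 0 < γ.exposure h k := fun k =>
    (γ.probMin_pos hU k).trans_le (hh k (k.2.trans_le ht1))
  obtain ⟨a, ha⟩ := γ.exists_reward_eq_opt hU fun i => (lam i : ℝ)
  have h1 := hpol.iter t ht1 h hD a
  have hidx : 0 < γ.index lmax h 0 := by
    have hL : 0 < Real.log ((t : ℝ) + 1) := Real.log_pos (by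
      have : (1 : ℝ) ≤ t := by exact_mod_cast ht1
      linarith)
    have := hD 0
    have := detected_nonneg h 0
    rw [index_eq]
    positivity
  simp only [reward, Fin.sum_univ_one] at h1 ha
  have h2 := le_of_mul_le_mul_right h1 hidx
  refine ENNReal.ofReal_of_nonpos ?_
  rw [gap, ← ha, reward, Fin.sum_univ_one, sub_nonpos]
  exact mul_le_mul_of_nonneg_right h2 (lam 0).2

end Detection

end Surveillance

/-! ### Assembly of the regret bound -/

theorem theorem1 {K U : ℕ} (hK : 0 < K) (hU : 0 < U) (γ : Surveillance.Detection K U)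
    (lam : Fin K → NNReal) (lmax : ℝ) (hlmax : ∀ k, (lam k : ℝ) ≤ lmax)
    (pol : Surveillance.Policy K U) (hpol : γ.IsFPCUCB lmax pol) (n : ℕ) :
    γ.regret lam pol n ≤
      (∑ k with 0 < γ.gapMin (fun i => lam i) k,
        12 * (K : ℝ) ^ 2 / γ.probMin k *
          (Surveillance.bfun K lmax (γ.gapMin (fun i => lam i) k) /
              γ.gapMin (fun i => lam i) k
            + ∫ x in (γ.gapMin (fun i => lam i) k)..(γ.gapMax (fun i => lam i) k),
                Surveillance.bfun K lmax x / x ^ 2)) * Real.log n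
      + (Real.pi ^ 2 / 3 + 1) * K * γ.gapMaxAll (fun i => lam i) := by
  have hl : 0 ≤ lmax := (lam ⟨0, hK⟩).2.trans (hlmax _)
  have hGM : 0 ≤ γ.gapMaxAll fun i => lam i :=
    (γ.gapMax_nonneg hU _ ⟨0, hK⟩).trans (γ.gapMax_le_gapMaxAll _ _)
  have hlead : 0 ≤ ∑ k with 0 < γ.gapMin (fun i => lam i) k, γ.leadingTerm lam lmax n k :=
    Finset.sum_nonneg fun k hk =>
      Surveillance.Detection.leadingTerm_nonneg hU hl n (Finset.mem_filter.1 hk).2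
  have hKGM : 0 ≤ K * γ.gapMaxAll fun i => lam i := by positivity
  have hpi : 2.74 + 1 / 3 ≤ Real.pi ^ 2 / 3 := by nlinarith [Real.pi_gt_d2]
  have hmain : ∑ t ∈ Finset.Ico K n, ∫⁻ h, ENNReal.ofReal (γ.gap (fun i => lam i) (pol t h))
        ∂γ.historyLaw lam pol t
      ≤ ENNReal.ofReal ((∑ k with 0 < γ.gapMin (fun i => lam i) k, γ.leadingTerm lam lmax n k)
          + (2.74 + 1 / 3) * K * γ.gapMaxAll fun i => lam i) := by
    -- The tail estimates require `t ≥ 2`, which holds in all rounds after initialisation only if `K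
    -- ≥ 2`.
    rcases (show K = 1 ∨ 2 ≤ K by omega) with rfl | hK2
    · rw [hpol.sum_main_eq_zero hU]
      exact zero_le
    · exact hpol.sum_main_le hK2 hU hlmax n
  have hsplit : ∑ t ∈ Finset.range n, ∫⁻ h, ENNReal.ofReal (γ.gap (fun i => lam i) (pol t h))
        ∂γ.historyLaw lam pol t
      ≤ (∑ t ∈ Finset.range K, ∫⁻ h, ENNReal.ofReal (γ.gap (fun i => lam i) (pol t h))
          ∂γ.historyLaw lam pol t)
        + ∑ t ∈ Finset.Ico K n, ∫⁻ h, ENNReal.ofReal (γ.gap (fun i => lam i) (pol t h))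
          ∂γ.historyLaw lam pol t := by
    rcases le_total n K with h | h
    · exact le_add_right (Finset.sum_le_sum_of_subset (Finset.range_subset_range.2 h))
    · rw [Finset.sum_range_add_sum_Ico _ h]
  rw [Finset.sum_mul]
  have hrhs : 0 ≤ (Real.pi ^ 2 / 3 + 1) * K * γ.gapMaxAll fun i => lam i := by positivity
  refine γ.regret_le_of_lintegral_le lam pol (add_nonneg hlead hrhs)
    ((hsplit.trans (add_le_add (hpol.sum_init_le) hmain)).trans ?_)
  rw [← ENNReal.ofReal_add hKGM (by
    have : 0 ≤ (2.74 + 1 / 3) * (K * γ.gapMaxAll fun i => lam i) := by positivity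
    linarith)]
  refine ENNReal.ofReal_le_ofReal ?_
  have := mul_le_mul_of_nonneg_right hpi hKGM
  have e : ∑ k with 0 < γ.gapMin (fun i => lam i) k, γ.leadingTerm lam lmax n k
    = ∑ k with 0 < γ.gapMin (fun i => lam i) k, 12 * (K : ℝ) ^ 2 / γ.probMin k *
          (Surveillance.bfun K lmax (γ.gapMin (fun i => lam i) k) /
              γ.gapMin (fun i => lam i) k
            + ∫ x in (γ.gapMin (fun i => lam i) k)..(γ.gapMax (fun i => lam i) k),
                Surveillance.bfun K lmax x / x ^ 2) * Real.log n := rfl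
  rw [← e]
  linarith
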